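/- Let $\eta\in L^2(\mathbb R^2)\cap C^0(\mathbb R^2)$ be real-valued and let $n\ge 3$ be an integer. For $m\ge 3$, call $x=(x_1,\dots,x_m)\in(\mathbb R^2)^m$ simple (with the convention $x_{m+1}=x_1$) if consecutive vertices are distinct, adjacent sides of the closed polygonal curve $\Gamma_x=[x_1,x_2]\cup\dots\cup[x_m,x_1]$ meet only at their common vertex, and non-adjacent sides are disjoint. Let $\mathcal X_m$ be the set of simple $x$; for $x\in\mathcal X_m$ let $E_x$ be the bounded region enclosed by the Jordan curve $\Gamma_x$, and let $\mathcal P_n$ be the set of all $E_x$ with $x\in\mathcal X_m$, $3\le m\le n$ (the simple polygons with at most $n$ sides). For $E\subset\mathbb R^2$ of finite positive perimeter put $\mathcal J(E)=\frac1{P(E)}\left|\int_E\eta\right|$, where $$P(E)=\sup\Big\{-\int_E\operatorname{div}z\;:\;z\in C_c^\infty(\mathbb R^2,\mathbb R^2),\ \|z\|_\infty\le 1\Big\}.$$ For $m\geq 3$ and $x\in(\mathbb R^2)^m$ put $$\mathcal P(x)=\sum_{i=1}^m\|x_{i+1}-x_i\|,\qquad \mathcal A(x)=\int_{\mathbb R^2}\eta\,\chi_x,$$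 where $\chi_x(y)$ is the winding number of the closed polygonal curve $[x_1,x_2],\dots,[x_m,x_1]$ around $y\notin\Gamma_x$; let $\mathcal Y_m=\{x\in(\mathbb R^2)^m:\mathcal P(x)>0\}$ and $\mathcal J(x)=|\mathcal A(x)|/\mathcal P(x)$ for $x\in\mathcal Y_m$. Then: 1. for every $m\ge3$ and $x\in\mathcal X_m$ one has $P(E_x)=\mathcal P(x)$ and $\left|\int_{E_x}\eta\right|=|\mathcal A(x)|$, hence $\mathcal J(E_x)=\mathcal J(x)$; 2. there is $x_*\in\mathcal X_n\cap\mathcal Y_n$ with $\mathcal J(x)\le\mathcal J(x_*)$ for all $x\in\mathcal Y_n$; so the relaxed energy attains its maximum over $\mathcal Y_n$, and does so at a simple polygon; 3. for this $x_*$ the simple polygon $E_{x_*}\in\mathcal P_n$ satisfies $\mathcal J(E)\le\mathcal J(E_{x_*})$ for all $E\in\mathcal P_n$; so $\mathcal J$ attains its maximum over the simple polygons with at most $n$ sides. -/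

import Mathlib

open MeasureTheory
open scoped ContDiff

noncomputable section

namespace CheegerPolygon

/-- The Euclidean plane `ℝ²`. -/
abbrev Plane : Type := EuclideanSpace ℝ (Fin 2)

/-! ### Total variation, perimeter and Cheeger ratio of a set -/

/-- The divergence of a vector field on the plane. -/
def divergence (z : Plane → Plane) (p : Plane) : ℝ :=
  ∑ i : Fin 2, (fderiv ℝ z p (EuclideanSpace.single i 1)) i

/-- The total variation of `u` (meant for locally integrable `u`): the supremum of `-∫ u div z`
over all smooth compactly supported vector fields `z` with `‖z‖ ≤ 1` everywhere. The field `z = 0`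
is admissible, so the truncation of negative values by `ENNReal.ofReal` is harmless. -/
def totalVariation (u : Plane → ℝ) : ENNReal :=
  ⨆ (z : Plane → Plane) (_ : ContDiff ℝ ∞ z) (_ : HasCompactSupport z) (_ : ∀ p, ‖z p‖ ≤ 1),
    ENNReal.ofReal (-∫ p, u p * divergence z p)

/-- The perimeter of a (measurable) set: the total variation of its indicator function. -/
def perimeter (E : Set Plane) : ENNReal :=
  totalVariation (E.indicator fun _ => 1)

/-- The Cheeger ratio `|∫_E η| / P(E)` of a set of finite positive perimeter. -/
def cheegerRatio (η : Plane → ℝ) (E : Set Plane) : ℝ :=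
  |∫ p in E, η p| / (perimeter E).toReal

/-! ### Simple polygons

`Polygon Plane m` is the type of `m`-tuples of points `x`; its `i`-th side is the segment
`x.edgeSet ℝ i` from `x i` to the cyclically next vertex `x (finRotate m i)`, and
`x.boundary ℝ` is the union of the sides. -/

/-- The closed polygonal curve through the vertices of `x` is simple: consecutive vertices are
distinct, adjacent sides meet only at their common vertex, and non-adjacent sides are disjoint
(used for `3 ≤ m`). -/
structure IsSimple {m : ℕ} (x : Polygon Plane m) : Prop where
  nondegenerate : x.HasNondegenerateEdges
  adjacent : ∀ i : Fin m,
    x.edgeSet ℝ i ∩ x.edgeSet ℝ (finRotate m i) = {x (finRotate m i)}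
  nonadjacent : ∀ i j : Fin m, i ≠ j → finRotate m i ≠ j → finRotate m j ≠ i →
    Disjoint (x.edgeSet ℝ i) (x.edgeSet ℝ j)

/-- The region enclosed by a polygonal curve: the points off the curve whose connected component
in the complement of the curve is bounded. When the curve is simple this is the
bounded one of the two regions into which the curve divides the plane. -/
def region {m : ℕ} (x : Polygon Plane m) : Set Plane :=
  {y | y ∉ x.boundary ℝ ∧ Bornology.IsBounded (connectedComponentIn (x.boundary ℝ)ᶜ y)}

/-- The set of simple polygons (as regions of the plane) with at most `n` sides. -/
def simplePolygons (n : ℕ) : Set (Set Plane) :=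
  {E | ∃ m : ℕ, 3 ≤ m ∧ m ≤ n ∧ ∃ x : Polygon Plane m, IsSimple x ∧ E = region x}

/-! ### The relaxed energy of a closed polygonal curve -/

/-- The length of the closed polygonal curve through the vertices of `x`. -/
def length {m : ℕ} (x : Polygon Plane m) : ℝ :=
  ∑ i : Fin m, ‖x (finRotate m i) - x i‖

/-- The determinant of the matrix with columns `u` and `v`. -/
def cross (u v : Plane) : ℝ := u 0 * v 1 - u 1 * v 0

/-- The winding number around `y` of the closed polygonal curve through the vertices of `x`, as
the integral of the angular form: `(1 / 2π) ∮ det (γ - y, γ') / ‖γ - y‖²`, where `γ` runs through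
the sides one after the other, each with constant speed. This is meaningful for `y` off the curve;
the curve itself is a null set, so that the values on it are immaterial in `relaxedArea`. -/
def windingNumber {m : ℕ} (x : Polygon Plane m) (y : Plane) : ℝ :=
  (2 * Real.pi)⁻¹ * ∑ i : Fin m, ∫ t in (0 : ℝ)..1,
    cross (x.edgePath ℝ i t - y) (x (finRotate m i) - x i) / ‖x.edgePath ℝ i t - y‖ ^ 2

/-- The relaxed weighted area `∫ η χ_x`, where `χ_x` is the winding number. -/
def relaxedArea (η : Plane → ℝ) {m : ℕ} (x : Polygon Plane m) : ℝ :=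
  ∫ y, η y * windingNumber x y

/-- The relaxed energy `|∫ η χ_x| / length x`, meant for curves of positive length. -/
def relaxedEnergy (η : Plane → ℝ) {m : ℕ} (x : Polygon Plane m) : ℝ :=
  |relaxedArea η x| / length x

/-- The closed polygonal curves with `m` vertices and positive length. -/
def polygonalCurves (m : ℕ) : Set (Polygon Plane m) := {x | 0 < length x}

end CheegerPolygon

end

/-! Off the curve, the winding number is a normalized sum over the sides of the angle `ang a b y`
under which a side is seen from `y` (`windingNumber_eq_wind`). These angles are additive along a
segment, so area and length are both sums over sides that can be cut and reassembled.

Simplification: a repeated vertex or a spike can be dropped without changing the area or increasing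
the length (`relaxedEnergy_le_of_drop`). At a self-intersection the curve splits into two closed
curves with fewer vertices whose areas and lengths add up, and by the mediant inequality one of them
has at least the same energy (`relaxedEnergy_le_of_cut`). Induction on the number of vertices gives
`exists_isSimple_relaxedEnergy_le`, and inserting midpoints restores the number of vertices to
exactly `n` (`exists_isSimple_of_le`).

Existence: curves with energy at least `c > 0` form a compact family. The small `L²` tail of `η`
keeps them from being long or far away, and local boundedness of `η` makes the area quadratic in the
length, so they cannot be short (`exists_bounds_of_le_relaxedEnergy`). The energy is continuous
there by dominated convergence, so a maximizer exists, and simplification makes it simple.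

Identification with sets: near each of its points a simple polygonal curve has two connected local
sides. Hence every complementary component touches the whole curve and there are at most two
components. The winding number jumps by one across a side and vanishes far away, so up to one global
sign it is the indicator of the region (`exists_wind_eq_indicator`). This gives the equality of
areas. For the perimeter, Gauss-Green (`integral_wind_mul_divergence`) is proved by writing the
winding number as a signed count of crossings of a vertical ray and applying Fubini. It bounds the
perimeter by the length, and fields close to the unit normal along the sides give the reverse
inequality. -/

noncomputable section

namespace CheegerPolygon

/-! ### Angles subtended by segments -/

/-- The isometric identification of the plane with `ℂ`. -/
def toC : Plane ≃ₗᵢ[ℝ] ℂ := Complex.orthonormalBasisOneI.repr.symm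

@[simp] lemma toC_re (p : Plane) : (toC p).re = p 0 := by
  simp [toC, Complex.orthonormalBasisOneI_repr_symm_apply]

@[simp] lemma toC_im (p : Plane) : (toC p).im = p 1 := by
  simp [toC, Complex.orthonormalBasisOneI_repr_symm_apply]

lemma toC_ne_zero {p : Plane} (h : p ≠ 0) : toC p ≠ 0 := by
  simpa using h

lemma norm_sq_eq (p : Plane) : ‖p‖ ^ 2 = p 0 ^ 2 + p 1 ^ 2 := by
  simp [EuclideanSpace.norm_sq_eq]

lemma cross_div_norm_sq (u v : Plane) : cross u v / ‖u‖ ^ 2 = (toC v / toC u).im := by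
  rw [Complex.div_im, Complex.normSq_apply, norm_sq_eq, toC_re, toC_im, toC_re, toC_im, cross]
  ring

lemma cross_smul_left (c : ℝ) (u w : Plane) : cross (c • u) w = c * cross u w := by
  simp [cross]; ring

lemma cross_smul_right (c : ℝ) (u w : Plane) : cross u (c • w) = c * cross u w := by
  simp [cross]; ring

lemma cross_add_right (u v w : Plane) : cross u (v + w) = cross u v + cross u w := by
  simp [cross]; ring

@[simp] lemma cross_self (u : Plane) : cross u u = 0 := by
  simp [cross]; ring

lemma cross_swap (u v : Plane) : cross u v = -cross v u := by
  simp [cross]; ring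

lemma continuous_cross {X : Type*} [TopologicalSpace X] {f g : X → Plane} (hf : Continuous f)
    (hg : Continuous g) : Continuous fun x => cross (f x) (g x) := by
  unfold cross; fun_prop

lemma abs_cross_le (u v : Plane) : |cross u v| ≤ ‖u‖ * ‖v‖ := by
  apply abs_le_of_sq_le_sq _ (by positivity)
  rw [mul_pow, norm_sq_eq, norm_sq_eq, cross]
  nlinarith [sq_nonneg (u 0 * v 0 + u 1 * v 1)]

/-- The oriented angle under which the segment from `a` to `b` is seen from `y`. -/
def ang (a b y : Plane) : ℝ := Complex.arg (toC (b - y) / toC (a - y))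

/-- The angular form integrated along the segment from `a` to `b`. -/
def angleIntegral (a b y : Plane) : ℝ :=
  ∫ t in (0 : ℝ)..1, cross (AffineMap.lineMap a b t - y) (b - a) / ‖AffineMap.lineMap a b t - y‖ ^ 2

/-- A quotient off the slit plane is a real `q ≤ 0` with `b - y = q (a - y)`, which exhibits `y` as
a convex combination of `a` and `b`. So the principal argument is continuous at every quotient that
occurs for a segment missing `y`. -/
lemma toC_div_mem_slitPlane {a b y : Plane} (h : y ∉ segment ℝ a b) :
    toC (b - y) / toC (a - y) ∈ Complex.slitPlane := by
  by_contra hq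
  rw [Complex.mem_slitPlane_iff, not_or, not_lt, not_not] at hq
  obtain ⟨hre, him⟩ := hq
  have ha : a - y ≠ 0 := by
    intro h0
    exact h (by rw [← sub_eq_zero.mp h0]; exact left_mem_segment ℝ a b)
  set q := toC (b - y) / toC (a - y) with hqdef
  have h1 : toC (b - y) = q.re • toC (a - y) := by
    have : q = (q.re : ℂ) := by apply Complex.ext <;> simp [him]
    rw [Complex.real_smul, ← this, hqdef, div_mul_cancel₀ _ (toC_ne_zero ha)]
  rw [← map_smul] at h1
  have h2 : b - y = q.re • (a - y) := toC.injective h1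
  have hpos : 0 < 1 - q.re := by linarith
  apply h
  refine ⟨(-q.re) / (1 - q.re), 1 / (1 - q.re), by apply div_nonneg <;> linarith, by positivity,
    by field_simp; ring, ?_⟩
  have h3 : b = y + q.re • (a - y) := by rw [← h2]; abel
  rw [h3]
  have : (1 - q.re) ≠ 0 := hpos.ne'
  ext i
  simp
  field_simp
  ring

lemma lineMap_mem_segment {E : Type*} [AddCommGroup E] [Module ℝ E] (a b : E) {t : ℝ}
    (ht : t ∈ Set.Icc (0 : ℝ) 1) : AffineMap.lineMap a b t ∈ segment ℝ a b := by
  rw [segment_eq_image_lineMap]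
  exact ⟨t, ht, rfl⟩

lemma ne_of_notMem_segment {a b y : Plane} (h : y ∉ segment ℝ a b) {t : ℝ}
    (ht : t ∈ Set.Icc (0 : ℝ) 1) : AffineMap.lineMap a b t - y ≠ 0 := by
  intro h0
  exact h (by rw [← sub_eq_zero.mp h0]; exact lineMap_mem_segment a b ht)

lemma continuous_lineMap (a b : Plane) :
    Continuous fun t : ℝ => (AffineMap.lineMap a b t : Plane) :=
  AffineMap.lineMap_continuous

lemma continuousOn_angularForm {a b y : Plane} (h : y ∉ segment ℝ a b) :
    ContinuousOn (fun t : ℝ => cross (AffineMap.lineMap a b t - y) (b - a) /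
      ‖AffineMap.lineMap a b t - y‖ ^ 2) (Set.Icc 0 1) := by
  refine ContinuousOn.div ?_ ?_ ?_
  · exact (continuous_cross ((continuous_lineMap a b).sub continuous_const)
      continuous_const).continuousOn
  · exact (((continuous_lineMap a b).sub continuous_const).norm.pow 2).continuousOn
  · intro t ht
    simpa using ne_of_notMem_segment h ht

/-- The angular form is the derivative of the imaginary part of `log ((γ - y) / (a - y))`. No change
of branch occurs, because each initial piece of the segment also misses `y`. -/
lemma angleIntegral_eq_ang {a b y : Plane} (h : y ∉ segment ℝ a b) :
    angleIntegral a b y = ang a b y := by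
  have ha : a - y ≠ 0 := by simpa using ne_of_notMem_segment h (t := 0) (by simp)
  have hderiv : ∀ t ∈ Set.uIcc (0 : ℝ) 1, HasDerivAt
      (fun t : ℝ => (Complex.log (toC (AffineMap.lineMap a b t - y) / toC (a - y))).im)
      (cross (AffineMap.lineMap a b t - y) (b - a) / ‖AffineMap.lineMap a b t - y‖ ^ 2) t := by
    intro t ht
    rw [Set.uIcc_of_le zero_le_one] at ht
    have hs : y ∉ segment ℝ a (AffineMap.lineMap a b t) := fun hy =>
      h ((convex_segment a b).segment_subset (left_mem_segment ℝ a b)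
        (lineMap_mem_segment a b ht) hy)
    have h1 : HasDerivAt (fun t : ℝ => (AffineMap.lineMap a b t : Plane)) (b - a) t := by
      simpa using AffineMap.hasDerivAt_lineMap (a := a) (b := b) (x := t)
    have h2 : HasDerivAt (fun t : ℝ => toC (AffineMap.lineMap a b t - y)) (toC (b - a)) t :=
      toC.toContinuousLinearEquiv.toContinuousLinearMap.hasFDerivAt.comp_hasDerivAt t
        (h1.sub_const y)
    have h3 := (h2.div_const (toC (a - y))).clog_real (toC_div_mem_slitPlane hs)
    have h4 := Complex.imCLM.hasFDerivAt.comp_hasDerivAt t h3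
    convert! h4 using 1
    rw [cross_div_norm_sq, Complex.imCLM_apply, div_div_div_cancel_right₀ (toC_ne_zero ha)]
  unfold angleIntegral ang
  rw [intervalIntegral.integral_eq_sub_of_hasDerivAt hderiv]
  · simp [Complex.log_im]
  · apply ContinuousOn.intervalIntegrable
    rw [Set.uIcc_of_le zero_le_one]
    exact continuousOn_angularForm h

lemma angleIntegral_lineMap (a b y : Plane) (s r : ℝ) :
    angleIntegral (AffineMap.lineMap a b s) (AffineMap.lineMap a b r) y =
      ∫ t in s..r, cross (AffineMap.lineMap a b t - y) (b - a) /
        ‖AffineMap.lineMap a b t - y‖ ^ 2 := by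
  rcases eq_or_ne s r with rfl | hsr
  · simp [angleIntegral, cross]
  have hc : r - s ≠ 0 := sub_ne_zero.mpr hsr.symm
  have key := intervalIntegral.integral_comp_mul_add (a := 0) (b := 1)
    (fun t : ℝ => cross (AffineMap.lineMap a b t - y) (b - a) /
        ‖AffineMap.lineMap a b t - y‖ ^ 2) hc s
  simp only [mul_zero, zero_add, mul_one, sub_add_cancel] at key
  rw [eq_inv_smul_iff₀ hc, ← intervalIntegral.integral_smul] at key
  rw [← key, angleIntegral]
  congr 1 with t
  have h1 : (AffineMap.lineMap (AffineMap.lineMap a b s : Plane) (AffineMap.lineMap a b r) t : Plane)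
      = AffineMap.lineMap a b ((r - s) * t + s) := by
    simp only [AffineMap.lineMap_apply_module']
    module
  have h2 : (AffineMap.lineMap a b r : Plane) - AffineMap.lineMap a b s = (r - s) • (b - a) := by
    simp only [AffineMap.lineMap_apply_module']
    module
  rw [h1, h2, cross_smul_right, smul_eq_mul, mul_div_assoc]

lemma ang_lineMap {a b y : Plane} (h : y ∉ segment ℝ a b) {s r : ℝ}
    (hs : s ∈ Set.Icc (0 : ℝ) 1) (hr : r ∈ Set.Icc (0 : ℝ) 1) :
    ang (AffineMap.lineMap a b s) (AffineMap.lineMap a b r) y =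
      ∫ t in s..r, cross (AffineMap.lineMap a b t - y) (b - a) /
        ‖AffineMap.lineMap a b t - y‖ ^ 2 := by
  rw [← angleIntegral_lineMap, angleIntegral_eq_ang]
  exact fun hy => h ((convex_segment a b).segment_subset (lineMap_mem_segment a b hs)
    (lineMap_mem_segment a b hr) hy)

/-- Angles are additive along a segment. -/
lemma ang_add_ang_of_mem {a b p q r y : Plane} (h : y ∉ segment ℝ a b) (hp : p ∈ segment ℝ a b)
    (hq : q ∈ segment ℝ a b) (hr : r ∈ segment ℝ a b) : ang p q y + ang q r y = ang p r y := by
  rw [segment_eq_image_lineMap] at hp hq hr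
  obtain ⟨s, hs, rfl⟩ := hp
  obtain ⟨t, ht, rfl⟩ := hq
  obtain ⟨u, hu, rfl⟩ := hr
  have hI : ∀ {v w : ℝ}, v ∈ Set.Icc (0 : ℝ) 1 → w ∈ Set.Icc (0 : ℝ) 1 →
      IntervalIntegrable (fun t : ℝ => cross (AffineMap.lineMap a b t - y) (b - a) /
        ‖AffineMap.lineMap a b t - y‖ ^ 2) volume v w := by
    intro v w hv hw
    apply ContinuousOn.intervalIntegrable
    exact (continuousOn_angularForm h).mono (Set.uIcc_subset_Icc hv hw)
  rw [ang_lineMap h hs ht, ang_lineMap h ht hu, ang_lineMap h hs hu,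
    intervalIntegral.integral_add_adjacent_intervals (hI hs ht) (hI ht hu)]

@[simp] lemma ang_self (a y : Plane) : ang a a y = 0 := by
  unfold ang
  by_cases h : toC (a - y) = 0
  · simp [h]
  · rw [div_self h, Complex.arg_one]

lemma abs_ang_le (a b y : Plane) : |ang a b y| ≤ Real.pi := Complex.abs_arg_le_pi _

lemma measurable_ang (a b : Plane) : Measurable (ang a b) := by
  unfold ang
  have h : ∀ c : Plane, Measurable fun y => toC (c - y) := fun c =>
    (toC.continuous.comp (continuous_const.sub continuous_id)).measurable
  exact Complex.measurable_arg.comp ((h b).div (h a))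

lemma continuousAt_ang {a b y : Plane} (h : y ∉ segment ℝ a b) :
    ContinuousAt (fun q : Plane × Plane × Plane => ang q.1 q.2.1 q.2.2) (a, b, y) := by
  unfold ang
  have ha : toC (a - y) ≠ 0 :=
    toC_ne_zero (by simpa using ne_of_notMem_segment h (t := 0) (by simp))
  refine ContinuousAt.comp (f := fun q : Plane × Plane × Plane =>
    toC (q.2.1 - q.2.2) / toC (q.1 - q.2.2)) (g := Complex.arg)
    (Complex.continuousAt_arg (toC_div_mem_slitPlane h)) ?_
  apply ContinuousAt.div
  · exact (toC.continuous.comp (by fun_prop)).continuousAt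
  · exact (toC.continuous.comp (by fun_prop)).continuousAt
  · exact ha

lemma ang_coe_angle {a b y : Plane} (ha : a ≠ y) (hb : b ≠ y) :
    (ang a b y : Real.Angle) =
      (Complex.arg (toC (b - y)) : Real.Angle) - Complex.arg (toC (a - y)) :=
  Complex.arg_div_coe_angle (toC_ne_zero (sub_ne_zero.mpr hb)) (toC_ne_zero (sub_ne_zero.mpr ha))

lemma arg_div_of_abs_sub_lt {u v : ℂ} (hu : u ≠ 0) (hv : v ≠ 0)
    (h : |v.arg - u.arg| < Real.pi) : (v / u).arg = v.arg - u.arg := by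
  have h1 := Complex.arg_div_coe_angle hv hu
  rw [← Real.Angle.coe_sub] at h1
  have h2 := congrArg Real.Angle.toReal h1
  rw [Real.Angle.toReal_coe_eq_self_iff.mpr ⟨Complex.neg_pi_lt_arg _, Complex.arg_le_pi _⟩,
    Real.Angle.toReal_coe_eq_self_iff.mpr ⟨(abs_lt.mp h).1, (abs_lt.mp h).2.le⟩] at h2
  exact h2

lemma volume_segment (a b : Plane) : volume (segment ℝ a b) = 0 := by
  have hsub : segment ℝ a b ⊆ (affineSpan ℝ {a, b} : AffineSubspace ℝ Plane) := by
    rw [← convexHull_pair]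
    exact convexHull_subset_affineSpan _
  refine measure_mono_null hsub (Measure.addHaar_affineSubspace volume _ ?_)
  intro htop
  have h1 : vectorSpan ℝ ({a, b} : Set Plane) = ⊤ := by
    rw [← direction_affineSpan, htop, AffineSubspace.direction_top]
  have h2 := finrank_vectorSpan_insert_le_set ℝ ({b} : Set Plane) a
  rw [h1, finrank_top, vectorSpan_singleton] at h2
  simp at h2

/-! ### Sums over the sides of a polygon and the winding number -/

/-- The sum of a function of ordered pairs of points over the sides of a polygon. -/
def edgeSum {M : Type*} [AddCommMonoid M] (Φ : Plane → Plane → M) {m : ℕ} (x : Polygon Plane m) :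
    M :=
  ∑ i : Fin m, Φ (x i) (x (finRotate m i))

/-- The winding number in terms of the angles subtended by the sides. -/
def wind {m : ℕ} (x : Polygon Plane m) (y : Plane) : ℝ :=
  (2 * Real.pi)⁻¹ * edgeSum (fun a b => ang a b y) x

lemma length_eq_edgeSum {m : ℕ} (x : Polygon Plane m) :
    length x = edgeSum (fun a b => ‖b - a‖) x := rfl

lemma length_nonneg {m : ℕ} (x : Polygon Plane m) : 0 ≤ length x :=
  Finset.sum_nonneg fun _ _ => norm_nonneg _

lemma edgeSet_eq_segment {m : ℕ} (x : Polygon Plane m) (i : Fin m) :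
    x.edgeSet ℝ i = segment ℝ (x i) (x (finRotate m i)) := by
  rw [Polygon.edgeSet, affineSegment_eq_segment]

lemma mem_boundary_iff {m : ℕ} {x : Polygon Plane m} {y : Plane} :
    y ∈ x.boundary ℝ ↔ ∃ i, y ∈ segment ℝ (x i) (x (finRotate m i)) := by
  simp only [Polygon.boundary, Set.mem_iUnion, edgeSet_eq_segment]

lemma notMem_boundary_iff {m : ℕ} {x : Polygon Plane m} {y : Plane} :
    y ∉ x.boundary ℝ ↔ ∀ i, y ∉ segment ℝ (x i) (x (finRotate m i)) := by
  rw [mem_boundary_iff, not_exists]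

lemma isCompact_segment (a b : Plane) : IsCompact (segment ℝ a b) := by
  rw [segment_eq_image_lineMap]
  exact isCompact_Icc.image (continuous_lineMap a b)

lemma isCompact_boundary {m : ℕ} (x : Polygon Plane m) : IsCompact (x.boundary ℝ) := by
  unfold Polygon.boundary
  refine isCompact_iUnion fun i => ?_
  rw [edgeSet_eq_segment]
  exact isCompact_segment _ _

lemma volume_boundary {m : ℕ} (x : Polygon Plane m) : volume (x.boundary ℝ) = 0 := by
  unfold Polygon.boundary
  refine measure_iUnion_null fun i => ?_
  rw [edgeSet_eq_segment]
  exact volume_segment _ _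

lemma ae_notMem_segment (a b : Plane) : ∀ᵐ y : Plane, y ∉ segment ℝ a b :=
  measure_eq_zero_iff_ae_notMem.mp (volume_segment a b)

lemma ae_notMem_boundary {m : ℕ} (x : Polygon Plane m) : ∀ᵐ y : Plane, y ∉ x.boundary ℝ :=
  measure_eq_zero_iff_ae_notMem.mp (volume_boundary x)

lemma windingNumber_eq_wind {m : ℕ} {x : Polygon Plane m} {y : Plane} (h : y ∉ x.boundary ℝ) :
    windingNumber x y = wind x y := by
  rw [notMem_boundary_iff] at h
  unfold windingNumber wind edgeSum
  congr 1
  exact Finset.sum_congr rfl fun i _ => angleIntegral_eq_ang (h i)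

lemma relaxedArea_eq (η : Plane → ℝ) {m : ℕ} (x : Polygon Plane m) :
    relaxedArea η x = ∫ y, η y * wind x y := by
  apply integral_congr_ae
  filter_upwards [ae_notMem_boundary x] with y hy
  rw [windingNumber_eq_wind hy]

lemma abs_wind_le {m : ℕ} (x : Polygon Plane m) (y : Plane) : |wind x y| ≤ m / 2 := by
  have h : |edgeSum (fun a b => ang a b y) x| ≤ m * Real.pi := by
    refine (Finset.abs_sum_le_sum_abs _ _).trans ?_
    refine (Finset.sum_le_sum fun i _ => abs_ang_le _ _ _).trans ?_
    simp
  rw [wind, abs_mul, abs_of_pos (by positivity)]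
  calc (2 * Real.pi)⁻¹ * |edgeSum (fun a b => ang a b y) x|
      ≤ (2 * Real.pi)⁻¹ * (m * Real.pi) := by gcongr
    _ = m / 2 := by field_simp

lemma measurable_wind {m : ℕ} (x : Polygon Plane m) : Measurable (wind x) := by
  unfold wind edgeSum
  exact (Finset.measurable_sum _ fun i _ => measurable_ang _ _).const_mul _

lemma continuousAt_wind {m : ℕ} {x : Fin m → Plane} {y : Plane}
    (h : y ∉ Polygon.boundary ℝ ⟨x⟩) :
    ContinuousAt (fun q : (Fin m → Plane) × Plane => wind ⟨q.1⟩ q.2) (x, y) := by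
  rw [notMem_boundary_iff] at h
  unfold wind edgeSum
  refine continuousAt_const.mul (tendsto_finsetSum _ fun i _ => ?_)
  refine ContinuousAt.comp (f := fun q : (Fin m → Plane) × Plane =>
    (q.1 i, q.1 (finRotate m i), q.2)) (continuousAt_ang (h i)) ?_
  exact Continuous.continuousAt (by fun_prop)

/-- Off the curve the winding number is an integer. -/
lemma exists_int_eq_wind {m : ℕ} {x : Polygon Plane m} {y : Plane} (h : y ∉ x.boundary ℝ) :
    ∃ k : ℤ, (k : ℝ) = wind x y := by
  rw [notMem_boundary_iff] at h
  have hne : ∀ i, x i ≠ y := fun i hi => h i (hi ▸ left_mem_segment ℝ _ _)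
  -- Modulo `2π` each angle is the difference of the arguments of its end points, and these
  -- differences cancel around the closed curve.
  have h0 : ((edgeSum (fun a b => ang a b y) x : ℝ) : Real.Angle) = 0 := by
    have h1 : ((edgeSum (fun a b => ang a b y) x : ℝ) : Real.Angle) =
        ∑ i, (ang (x i) (x (finRotate m i)) y : Real.Angle) :=
      map_sum Real.Angle.coeHom _ _
    rw [h1, Finset.sum_congr rfl fun i _ => ang_coe_angle (hne i) (hne _), Finset.sum_sub_distrib,
      Equiv.sum_comp (finRotate m) fun i => (Complex.arg (toC (x i - y)) : Real.Angle), sub_self]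
  obtain ⟨k, hk⟩ := Real.Angle.coe_eq_zero_iff.mp h0
  refine ⟨k, ?_⟩
  rw [wind, ← hk, zsmul_eq_mul]
  field_simp

/-- The closed polygon through the first `m` values of a sequence of points. -/
def ofFun (f : ℕ → Plane) (m : ℕ) : Polygon Plane m := ⟨fun i => f i⟩

lemma edgeSum_ofFun {M : Type*} [AddCommMonoid M] (Φ : Plane → Plane → M) (f : ℕ → Plane) (m : ℕ) :
    edgeSum Φ (ofFun f (m + 1)) =
      ∑ i ∈ Finset.range m, Φ (f i) (f (i + 1)) + Φ (f m) (f 0) := by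
  unfold edgeSum
  rw [Fin.sum_univ_castSucc]
  congr 1
  · rw [← Fin.sum_univ_eq_sum_range (fun i => Φ (f i) (f (i + 1)))]
    refine Finset.sum_congr rfl fun i _ => ?_
    simp [ofFun]
  · simp [ofFun]

/-- The vertices of a polygon, as a periodic sequence starting at the vertex number `c`. -/
def unroll {m : ℕ} (x : Polygon Plane (m + 1)) (c : Fin (m + 1)) (k : ℕ) : Plane :=
  x (Fin.ofNat (m + 1) k + c)

lemma unroll_val_sub {m : ℕ} (x : Polygon Plane (m + 1)) (c i : Fin (m + 1)) :
    unroll x c (i - c : Fin (m + 1)).val = x i := by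
  simp [unroll]

lemma unroll_val_sub_succ {m : ℕ} (x : Polygon Plane (m + 1)) (c i : Fin (m + 1)) :
    unroll x c ((i - c : Fin (m + 1)).val + 1) = x (i + 1) := by
  have h : Fin.ofNat (m + 1) ((i - c : Fin (m + 1)).val + 1) = i - c + 1 := by
    ext
    simp [Fin.val_add]
  rw [unroll, h]
  congr 1
  abel

@[simp] lemma unroll_zero {m : ℕ} (x : Polygon Plane (m + 1)) (c : Fin (m + 1)) :
    unroll x c 0 = x c := by
  simp [unroll]

lemma edgeSum_unroll {M : Type*} [AddCommMonoid M] (Φ : Plane → Plane → M) {m : ℕ}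
    (x : Polygon Plane (m + 1)) (c : Fin (m + 1)) :
    edgeSum Φ (ofFun (unroll x c) (m + 1)) = edgeSum Φ x := by
  unfold edgeSum
  rw [← Equiv.sum_comp (Equiv.addRight c) fun i => Φ (x i) (x (finRotate (m + 1) i))]
  refine Finset.sum_congr rfl fun i _ => ?_
  simp only [ofFun, unroll, Equiv.coe_addRight, Fin.ofNat_val_eq_self, finRotate_apply]
  rw [add_right_comm]

/-- Renumbering from `i` makes the path from `x i` to `x j` an initial part of the closed curve,
whose length bounds the distance. -/
lemma dist_vertices_le {m : ℕ} (x : Polygon Plane m) (i j : Fin m) :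
    dist (x i) (x j) ≤ length x := by
  obtain _ | m := m
  · exact i.elim0
  rw [length_eq_edgeSum, ← edgeSum_unroll _ x i, edgeSum_ofFun]
  have hj : unroll x i (j - i : Fin (m + 1)).val = x j := by simp [unroll]
  have hi : unroll x i 0 = x i := by simp [unroll]
  rw [← hj, ← hi]
  refine (dist_le_range_sum_dist _ _).trans ?_
  refine le_add_of_le_of_nonneg ?_ (norm_nonneg _)
  simp_rw [dist_eq_norm_sub']
  refine Finset.sum_le_sum_of_subset_of_nonneg ?_ fun _ _ _ => norm_nonneg _
  exact Finset.range_subset_range.mpr (Nat.le_of_lt_succ (Fin.is_lt _))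

/-- Both arguments on the right lie in `(-π/2, π/2)`, so their difference needs no correction by a
multiple of `2π`. -/
lemma abs_arg_sub_arg_lt {u v w : ℂ} (hw : w ≠ 0) (hu : 0 < (u / w).re) (hv : 0 < (v / w).re) :
    (v / u).arg = (v / w).arg - (u / w).arg := by
  have hu0 : u / w ≠ 0 := fun h => by simp [h] at hu
  have hv0 : v / w ≠ 0 := fun h => by simp [h] at hv
  have h := arg_div_of_abs_sub_lt hu0 hv0 (by
    have h1 := abs_lt.mp (Complex.abs_arg_lt_pi_div_two_iff.mpr (Or.inl hu))
    have h2 := abs_lt.mp (Complex.abs_arg_lt_pi_div_two_iff.mpr (Or.inl hv))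
    rw [abs_lt]
    constructor <;> linarith)
  rwa [div_div_div_cancel_right₀ hw] at h

lemma re_div_pos_of_norm_sub_lt {u w : ℂ} (h : ‖u - w‖ < ‖w‖) : 0 < (u / w).re := by
  have hw : w ≠ 0 := fun h0 => by simp [h0] at h; linarith [norm_nonneg u]
  have h1 : ‖u / w - 1‖ < 1 := by
    rw [div_sub_one hw, norm_div, div_lt_one (norm_pos_iff.mpr hw)]
    exact h
  have h2 := (abs_le.mp (Complex.abs_re_le_norm (u / w - 1))).1
  simp at h2
  linarith

/-- The winding number vanishes far away from the curve. -/
lemma wind_eq_zero_of_lt {m : ℕ} (x : Polygon Plane m) (i : Fin m) {y : Plane}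
    (h : length x < dist y (x i)) : wind x y = 0 := by
  -- Seen from a distant `y`, all vertices lie in one open half-plane, so the angles are true
  -- differences of arguments and telescope to zero.
  have hre : ∀ j, 0 < (toC (x j - y) / toC (x i - y)).re := by
    intro j
    apply re_div_pos_of_norm_sub_lt
    rw [← map_sub, LinearIsometryEquiv.norm_map, LinearIsometryEquiv.norm_map,
      sub_sub_sub_cancel_right, ← dist_eq_norm, ← dist_eq_norm_sub']
    exact (dist_vertices_le x j i).trans_lt h
  have hw : toC (x i - y) ≠ 0 := fun h0 => by simpa [h0] using hre i
  unfold wind edgeSum ang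
  rw [Finset.sum_congr rfl fun j _ => abs_arg_sub_arg_lt hw (hre j) (hre _),
    Finset.sum_sub_distrib,
    Equiv.sum_comp (finRotate m) fun j => (toC (x j - y) / toC (x i - y)).arg, sub_self, mul_zero]

/-- The centre `c` and radius `r` are free so that one integrable majorant serves all polygons near
a given one. -/
lemma norm_mul_wind_le (η : Plane → ℝ) {m : ℕ} (x : Polygon Plane m) (i : Fin m) (c : Plane)
    {r : ℝ} (hr : dist (x i) c + length x ≤ r) (y : Plane) :
    ‖η y * wind x y‖ ≤ (Metric.closedBall c r).indicator (fun y => m / 2 * |η y|) y := by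
  by_cases hy : y ∈ Metric.closedBall c r
  · rw [Set.indicator_of_mem hy, norm_mul, mul_comm, Real.norm_eq_abs, Real.norm_eq_abs]
    gcongr
    exact abs_wind_le x y
  · have hlt : length x < dist y (x i) := by
      rw [Metric.mem_closedBall, not_le] at hy
      linarith [dist_triangle y (x i) c]
    rw [wind_eq_zero_of_lt x i hlt, Set.indicator_of_notMem hy]
    simp

lemma integrable_indicator_closedBall {η : Plane → ℝ} (hc : Continuous η) (k : ℝ) (c : Plane)
    (r : ℝ) : Integrable ((Metric.closedBall c r).indicator fun y => k * |η y|) := by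
  rw [integrable_indicator_iff measurableSet_closedBall]
  exact (continuous_const.mul hc.abs).continuousOn.integrableOn_compact (isCompact_closedBall c r)

lemma integrable_mul_wind {η : Plane → ℝ} (hc : Continuous η) {m : ℕ} (x : Polygon Plane m) :
    Integrable fun y => η y * wind x y := by
  obtain _ | m := m
  · simp [wind, edgeSum]
  exact (integrable_indicator_closedBall hc _ (x 0) (length x)).mono'
    (hc.measurable.mul (measurable_wind x)).aestronglyMeasurable
    (Filter.Eventually.of_forall (norm_mul_wind_le η x 0 (x 0) (by simp)))

lemma abs_relaxedArea_le {η : Plane → ℝ} (hc : Continuous η) {m : ℕ} (x : Polygon Plane m)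
    (i : Fin m) :
    |relaxedArea η x| ≤ m / 2 * ∫ y in Metric.closedBall (x i) (length x), |η y| := by
  rw [relaxedArea_eq, ← Real.norm_eq_abs]
  refine (norm_integral_le_of_norm_le (integrable_indicator_closedBall hc _ (x i) (length x))
    (Filter.Eventually.of_forall (norm_mul_wind_le η x i (x i) (by simp)))).trans_eq ?_
  rw [integral_indicator measurableSet_closedBall, integral_const_mul]

lemma relaxedArea_congr (η : Plane → ℝ) {m k : ℕ} {x : Polygon Plane m} {x' : Polygon Plane k}
    (h : ∀ᵐ y : Plane, edgeSum (fun a b => ang a b y) x = edgeSum (fun a b => ang a b y) x') :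
    relaxedArea η x = relaxedArea η x' := by
  rw [relaxedArea_eq, relaxedArea_eq]
  apply integral_congr_ae
  filter_upwards [h] with y hy
  rw [wind, wind, hy]

lemma relaxedArea_add {η : Plane → ℝ} (hc : Continuous η) {m k l : ℕ} {x : Polygon Plane m}
    {x₁ : Polygon Plane k} {x₂ : Polygon Plane l}
    (h : ∀ᵐ y : Plane, edgeSum (fun a b => ang a b y) x =
      edgeSum (fun a b => ang a b y) x₁ + edgeSum (fun a b => ang a b y) x₂) :
    relaxedArea η x = relaxedArea η x₁ + relaxedArea η x₂ := by
  rw [relaxedArea_eq, relaxedArea_eq, relaxedArea_eq,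
    ← integral_add (integrable_mul_wind hc x₁) (integrable_mul_wind hc x₂)]
  apply integral_congr_ae
  filter_upwards [h] with y hy
  rw [wind, wind, wind, hy]
  ring

lemma relaxedArea_eq_zero_of_length_eq_zero (η : Plane → ℝ) {m : ℕ} {x : Polygon Plane m}
    (h : length x = 0) : relaxedArea η x = 0 := by
  have hx : ∀ i, x (finRotate m i) = x i := by
    intro i
    have := (Finset.sum_eq_zero_iff_of_nonneg fun i _ => norm_nonneg _).mp h i (Finset.mem_univ i)
    exact sub_eq_zero.mp (norm_eq_zero.mp this)
  rw [relaxedArea_eq]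
  simp only [wind, edgeSum, hx, ang_self, Finset.sum_const_zero, mul_zero, integral_zero]

lemma relaxedEnergy_nonneg (η : Plane → ℝ) {m : ℕ} (x : Polygon Plane m) :
    0 ≤ relaxedEnergy η x := div_nonneg (abs_nonneg _) (length_nonneg x)

lemma length_pos_of_relaxedEnergy_pos {η : Plane → ℝ} {m : ℕ} {x : Polygon Plane m}
    (h : 0 < relaxedEnergy η x) : 0 < length x := by
  refine (length_nonneg x).lt_of_ne fun h0 => ?_
  simp [relaxedEnergy, ← h0] at h

/-! ### Reduction to simple polygons -/

lemma relaxedArea_unroll (η : Plane → ℝ) {m : ℕ} (x : Polygon Plane (m + 1)) (c : Fin (m + 1)) :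
    relaxedArea η (ofFun (unroll x c) (m + 1)) = relaxedArea η x :=
  relaxedArea_congr η (Filter.Eventually.of_forall fun _ => edgeSum_unroll _ x c)

lemma length_unroll {m : ℕ} (x : Polygon Plane (m + 1)) (c : Fin (m + 1)) :
    length (ofFun (unroll x c) (m + 1)) = length x :=
  edgeSum_unroll (fun a b => ‖b - a‖) x c

lemma relaxedEnergy_unroll (η : Plane → ℝ) {m : ℕ} (x : Polygon Plane (m + 1)) (c : Fin (m + 1)) :
    relaxedEnergy η (ofFun (unroll x c) (m + 1)) = relaxedEnergy η x := by
  rw [relaxedEnergy, relaxedEnergy, relaxedArea_unroll, length_unroll]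

/-- A vertex at which the curve backtracks or stops can be dropped. -/
lemma relaxedEnergy_le_of_drop {η : Plane → ℝ} {f : ℕ → Plane} {m : ℕ}
    (hpos : 0 < relaxedEnergy η (ofFun f (m + 2)))
    (h : ∀ᵐ y : Plane, ang (f m) (f (m + 1)) y + ang (f (m + 1)) (f 0) y = ang (f m) (f 0) y) :
    relaxedEnergy η (ofFun f (m + 2)) ≤ relaxedEnergy η (ofFun f (m + 1)) := by
  have hA : relaxedArea η (ofFun f (m + 2)) = relaxedArea η (ofFun f (m + 1)) := by
    apply relaxedArea_congr
    filter_upwards [h] with y hy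
    rw [edgeSum_ofFun, edgeSum_ofFun, Finset.sum_range_succ, add_assoc, hy]
  have hL : length (ofFun f (m + 1)) ≤ length (ofFun f (m + 2)) := by
    rw [length_eq_edgeSum, length_eq_edgeSum, edgeSum_ofFun, edgeSum_ofFun, Finset.sum_range_succ,
      add_assoc]
    gcongr
    simpa [dist_eq_norm_sub'] using dist_triangle (f m) (f (m + 1)) (f 0)
  -- The shorter curve must have positive length: a quotient by zero would count as energy zero and
  -- the comparison would fail.
  have hne : relaxedArea η (ofFun f (m + 1)) ≠ 0 := by
    intro h0
    rw [relaxedEnergy, hA, h0] at hpos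
    simp at hpos
  have hL' : 0 < length (ofFun f (m + 1)) :=
    (length_nonneg _).lt_of_ne fun h0 => hne (relaxedArea_eq_zero_of_length_eq_zero η h0.symm)
  rw [relaxedEnergy, relaxedEnergy, hA]
  gcongr

/-- Mediant inequality: `|A₁ + A₂| / (L₁ + L₂)` cannot exceed both `|A₁| / L₁` and `|A₂| / L₂`. A
piece of length zero has area zero and is harmless, since the other piece then carries the strict
inequality. -/
lemma exists_le_of_split {η : Plane → ℝ} {m k l : ℕ} {x : Polygon Plane m}
    {x₁ : Polygon Plane k} {x₂ : Polygon Plane l} (hpos : 0 < relaxedEnergy η x)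
    (hA : relaxedArea η x = relaxedArea η x₁ + relaxedArea η x₂)
    (hL : length x = length x₁ + length x₂) :
    relaxedEnergy η x ≤ relaxedEnergy η x₁ ∨ relaxedEnergy η x ≤ relaxedEnergy η x₂ := by
  by_contra! h
  obtain ⟨h1, h2⟩ := h
  have hle : ∀ {j : ℕ} (z : Polygon Plane j), relaxedEnergy η z < relaxedEnergy η x →
      |relaxedArea η z| ≤ relaxedEnergy η x * length z ∧
        (0 < length z → |relaxedArea η z| < relaxedEnergy η x * length z) := by
    intro j z hz
    have hlt : 0 < length z → |relaxedArea η z| < relaxedEnergy η x * length z := fun h0 => by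
      rwa [relaxedEnergy, div_lt_iff₀ h0] at hz
    refine ⟨?_, hlt⟩
    rcases (length_nonneg z).eq_or_lt with h0 | h0
    · rw [relaxedArea_eq_zero_of_length_eq_zero η h0.symm, ← h0]
      simp
    · exact (hlt h0).le
  have hx : |relaxedArea η x| = relaxedEnergy η x * length x := by
    rw [relaxedEnergy, div_mul_cancel₀ _ (length_pos_of_relaxedEnergy_pos hpos).ne']
  have hpos' := length_pos_of_relaxedEnergy_pos hpos
  have htri := abs_add_le (relaxedArea η x₁) (relaxedArea η x₂)
  rw [← hA, hx, hL, mul_add] at htri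
  obtain ⟨h1, h1'⟩ := hle x₁ h1
  obtain ⟨h2, h2'⟩ := hle x₂ h2
  rcases (length_nonneg x₁).eq_or_lt with h0 | h0
  · linarith [h2' (by linarith)]
  · linarith [h1' h0]

/-- At a common point of two sides, a closed polygonal curve splits into two. -/
lemma relaxedEnergy_le_of_cut {η : Plane → ℝ} (hc : Continuous η) {f : ℕ → Plane} {j k : ℕ}
    (hpos : 0 < relaxedEnergy η (ofFun f (j + k + 2))) {p : Plane}
    (hp : p ∈ segment ℝ (f j) (f (j + 1)))
    (hp' : p ∈ segment ℝ (f (j + k + 1)) (f 0)) :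
    ∃ g, relaxedEnergy η (ofFun f (j + k + 2)) ≤ relaxedEnergy η (ofFun g (j + 2)) ∨
      relaxedEnergy η (ofFun f (j + k + 2)) ≤ relaxedEnergy η (ofFun g (k + 2)) := by
  -- One piece keeps the vertices `0, …, j`, the other the vertices `j + 1, …, j + k + 1`, and each
  -- is closed up through `p`.
  let f₁ : ℕ → Plane := fun i => if i ≤ j then f i else p
  let f₂ : ℕ → Plane := fun i => if i ≤ k then f (j + 1 + i) else p
  have h₁ : ∀ Φ : Plane → Plane → ℝ, edgeSum Φ (ofFun f₁ (j + 2)) =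
      ∑ i ∈ Finset.range j, Φ (f i) (f (i + 1)) + Φ (f j) p + Φ p (f 0) := by
    intro Φ
    rw [edgeSum_ofFun, Finset.sum_range_succ]
    congr 2
    · refine Finset.sum_congr rfl fun i hi => ?_
      have := Finset.mem_range.mp hi
      simp only [f₁]
      rw [if_pos (by omega), if_pos (by omega)]
    · simp [f₁]
    · simp [f₁]
  have h₂ : ∀ Φ : Plane → Plane → ℝ, edgeSum Φ (ofFun f₂ (k + 2)) =
      ∑ i ∈ Finset.range k, Φ (f (j + 1 + i)) (f (j + 1 + i + 1)) + Φ (f (j + 1 + k)) p +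
        Φ p (f (j + 1)) := by
    intro Φ
    rw [edgeSum_ofFun, Finset.sum_range_succ]
    congr 2
    · refine Finset.sum_congr rfl fun i hi => ?_
      have := Finset.mem_range.mp hi
      simp only [f₂]
      rw [if_pos (by omega), if_pos (by omega), add_assoc (j + 1)]
    · simp [f₂]
    · simp [f₂]
  have h : ∀ Φ : Plane → Plane → ℝ, edgeSum Φ (ofFun f (j + k + 2)) =
      ∑ i ∈ Finset.range j, Φ (f i) (f (i + 1)) + Φ (f j) (f (j + 1)) +
        ∑ i ∈ Finset.range k, Φ (f (j + 1 + i)) (f (j + 1 + i + 1)) + Φ (f (j + k + 1)) (f 0) := by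
    intro Φ
    rw [edgeSum_ofFun, show j + k + 1 = (j + 1) + k by ring, Finset.sum_range_add,
      Finset.sum_range_succ]
  have hsum : ∀ Φ : Plane → Plane → ℝ, Φ (f j) p + Φ p (f (j + 1)) = Φ (f j) (f (j + 1)) →
      Φ (f (j + k + 1)) p + Φ p (f 0) = Φ (f (j + k + 1)) (f 0) →
      edgeSum Φ (ofFun f (j + k + 2)) =
        edgeSum Φ (ofFun f₁ (j + 2)) + edgeSum Φ (ofFun f₂ (k + 2)) := by
    intro Φ e1 e2
    rw [h, h₁, h₂, ← e1, ← e2, show j + 1 + k = j + k + 1 by ring]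
    ring
  have hA : relaxedArea η (ofFun f (j + k + 2)) =
      relaxedArea η (ofFun f₁ (j + 2)) + relaxedArea η (ofFun f₂ (k + 2)) := by
    apply relaxedArea_add hc
    filter_upwards [ae_notMem_segment (f j) (f (j + 1)),
      ae_notMem_segment (f (j + k + 1)) (f 0)] with y hy hy'
    exact hsum _
      (ang_add_ang_of_mem hy (left_mem_segment ℝ _ _) hp (right_mem_segment ℝ _ _))
      (ang_add_ang_of_mem hy' (left_mem_segment ℝ _ _) hp' (right_mem_segment ℝ _ _))
  have hL : length (ofFun f (j + k + 2)) =
      length (ofFun f₁ (j + 2)) + length (ofFun f₂ (k + 2)) := by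
    apply hsum fun a b => ‖b - a‖
    · simpa [dist_eq_norm_sub'] using dist_add_dist_of_mem_segment hp
    · simpa [dist_eq_norm_sub'] using dist_add_dist_of_mem_segment hp'
  rcases exists_le_of_split hpos hA hL with h | h
  exacts [⟨f₁, Or.inl h⟩, ⟨f₂, Or.inr h⟩]

/-- Two segments from a common point `b` with another common point lie one inside the other. -/
lemma mem_segment_or_mem_segment {a b c q : Plane} (hq : q ≠ b) (h1 : q ∈ segment ℝ a b)
    (h2 : q ∈ segment ℝ b c) : c ∈ segment ℝ a b ∨ a ∈ segment ℝ b c := by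
  rw [segment_symm] at h1
  rw [segment_eq_image_lineMap] at h1 h2
  obtain ⟨s, hs, hsq⟩ := h1
  obtain ⟨t, ht, htq⟩ := h2
  rw [AffineMap.lineMap_apply_module'] at hsq htq
  have hs0 : s ≠ 0 := fun h => hq (by rw [← hsq, h]; simp)
  have ht0 : t ≠ 0 := fun h => hq (by rw [← htq, h]; simp)
  have hs' : 0 < s := hs.1.lt_of_ne hs0.symm
  have ht' : 0 < t := ht.1.lt_of_ne ht0.symm
  have heq : s • (a - b) = t • (c - b) := by
    have := hsq.trans htq.symm
    exact add_right_cancel this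
  rcases le_total s t with h | h
  · left
    rw [segment_symm, segment_eq_image_lineMap]
    refine ⟨s / t, ⟨by positivity, by rw [div_le_one ht']; exact h⟩, ?_⟩
    rw [AffineMap.lineMap_apply_module', div_eq_inv_mul, mul_smul, heq, inv_smul_smul₀ ht0]
    abel
  · right
    rw [segment_eq_image_lineMap]
    refine ⟨t / s, ⟨by positivity, by rw [div_le_one hs']; exact h⟩, ?_⟩
    rw [AffineMap.lineMap_apply_module', div_eq_inv_mul, mul_smul, ← heq, inv_smul_smul₀ hs0]
    abel

/-- At a spike all three points lie on one of the two sides, where angles are additive off a null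
set. -/
lemma ae_ang_add_ang_of_spike {a b c q : Plane} (hq : q ≠ b) (h1 : q ∈ segment ℝ a b)
    (h2 : q ∈ segment ℝ b c) : ∀ᵐ y : Plane, ang a b y + ang b c y = ang a c y := by
  rcases mem_segment_or_mem_segment hq h1 h2 with h | h
  · filter_upwards [ae_notMem_segment a b] with y hy
    exact ang_add_ang_of_mem hy (left_mem_segment ℝ _ _) (right_mem_segment ℝ _ _) h
  · filter_upwards [ae_notMem_segment b c] with y hy
    exact ang_add_ang_of_mem hy h (left_mem_segment ℝ _ _) (right_mem_segment ℝ _ _)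

/-- A curve with two vertices runs back along its only segment, so its angles cancel. Hence positive
energy forces at least three vertices, and the descent on the number of vertices ends at an honest
polygon. -/
lemma relaxedArea_eq_zero_of_lt_three (η : Plane → ℝ) {m : ℕ} (hm : m < 3)
    (x : Polygon Plane m) : relaxedArea η x = 0 := by
  suffices h : ∀ᵐ y : Plane, edgeSum (fun a b => ang a b y) x = 0 by
    rw [relaxedArea_eq]
    refine integral_eq_zero_of_ae ?_
    filter_upwards [h] with y hy
    simp [wind, hy]
  interval_cases m
  · simp [edgeSum]
  · simp [edgeSum]
  · filter_upwards [ae_notMem_segment (x 0) (x 1)] with y hy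
    have := ang_add_ang_of_mem hy (left_mem_segment ℝ _ _) (right_mem_segment ℝ _ _)
      (left_mem_segment ℝ _ _)
    rw [ang_self] at this
    simpa [edgeSum, Fin.sum_univ_two] using this

/-- A closed polygonal curve that is not simple has two equal consecutive vertices, or a
spike, or a self-intersection. -/
lemma exists_of_not_isSimple {m : ℕ} {x : Polygon Plane (m + 1)} (h : ¬ IsSimple x) :
    (∃ i, x i = x (i + 1)) ∨
    (∃ i, ∃ q ≠ x (i + 1), q ∈ segment ℝ (x i) (x (i + 1)) ∧
      q ∈ segment ℝ (x (i + 1)) (x (i + 1 + 1))) ∨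
    ∃ i j, i ≠ j ∧ i + 1 ≠ j ∧ j + 1 ≠ i ∧ ∃ q, q ∈ segment ℝ (x i) (x (i + 1)) ∧
      q ∈ segment ℝ (x j) (x (j + 1)) := by
  by_contra! hcon
  obtain ⟨h1, h2, h3⟩ := hcon
  refine h ⟨fun i => ?_, fun i => ?_, fun i j hij hij' hji => ?_⟩
  · rw [finRotate_apply]
    exact h1 i
  · simp only [edgeSet_eq_segment, finRotate_apply]
    refine Set.Subset.antisymm (fun q hq => ?_) ?_
    · by_contra hne
      exact h2 i q hne hq.1 hq.2
    · rw [Set.singleton_subset_iff]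
      exact ⟨right_mem_segment ℝ _ _, left_mem_segment ℝ _ _⟩
  · simp only [edgeSet_eq_segment, finRotate_apply] at hij' hji ⊢
    rw [Set.disjoint_left]
    exact h3 i j hij hij' hji

/-- For every closed polygonal curve of positive energy there is a simple polygon with at most as
many vertices and at least the same energy. -/
theorem exists_isSimple_relaxedEnergy_le {η : Plane → ℝ} (hc : Continuous η) :
    ∀ (m : ℕ) (x : Polygon Plane m), 0 < relaxedEnergy η x →
      ∃ k, 3 ≤ k ∧ k ≤ m ∧ ∃ y : Polygon Plane k, IsSimple y ∧
        relaxedEnergy η x ≤ relaxedEnergy η y := by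
  intro m
  induction m using Nat.strong_induction_on with
  | _ m ih =>
  intro x hx
  by_cases hm : m < 3
  · rw [relaxedEnergy, relaxedArea_eq_zero_of_lt_three η hm] at hx
    simp at hx
  push Not at hm
  by_cases hs : IsSimple x
  · exact ⟨m, hm, le_rfl, x, hs, le_rfl⟩
  have step : ∀ k < m, ∀ z : Polygon Plane k, relaxedEnergy η x ≤ relaxedEnergy η z →
      ∃ k, 3 ≤ k ∧ k ≤ m ∧ ∃ y : Polygon Plane k, IsSimple y ∧
        relaxedEnergy η x ≤ relaxedEnergy η y := by
    intro k hk z hz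
    obtain ⟨l, hl, hlk, y, hy, hzy⟩ := ih k hk z (hx.trans_le hz)
    exact ⟨l, hl, by omega, y, hy, hz.trans hzy⟩
  obtain ⟨m, rfl⟩ : ∃ n, m = n + 2 := ⟨m - 2, by omega⟩
  have hdrop : ∀ i : Fin (m + 2),
      (∀ᵐ y : Plane, ang (x i) (x (i + 1)) y + ang (x (i + 1)) (x (i + 1 + 1)) y
        = ang (x i) (x (i + 1 + 1)) y) →
      ∃ k, 3 ≤ k ∧ k ≤ m + 2 ∧ ∃ y : Polygon Plane k, IsSimple y ∧
        relaxedEnergy η x ≤ relaxedEnergy η y := by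
    -- Numbering from the vertex after the spike puts the spike `i + 1` in the last place `m + 1`
    -- and its predecessor in place `m`, as required for dropping it.
    intro i hi
    have e : i - (i + 1 + 1) = Fin.ofNat (m + 2) m := by
      rw [sub_eq_iff_eq_add]
      have : (Fin.ofNat (m + 2) m) + 1 + 1 = 0 := by
        ext
        simp [Fin.val_add]
      calc i = i + 0 := (add_zero i).symm
        _ = Fin.ofNat (m + 2) m + (i + 1 + 1) := by rw [← this]; abel
    have e' : (i - (i + 1 + 1) : Fin (m + 2)).val = m := by
      rw [e]
      simp
    have h1 := unroll_val_sub x (i + 1 + 1) i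
    have h2 := unroll_val_sub_succ x (i + 1 + 1) i
    rw [e'] at h1 h2
    refine step (m + 1) (by omega) (ofFun (unroll x (i + 1 + 1)) (m + 1)) ?_
    have hen := relaxedEnergy_unroll η x (i + 1 + 1)
    rw [← hen]
    apply relaxedEnergy_le_of_drop
    · rwa [hen]
    · rwa [h1, h2, unroll_zero]
  rcases exists_of_not_isSimple hs with ⟨i, hi⟩ | ⟨i, q, hq, h1, h2⟩ |
    ⟨i, j, hij, hij', hji, q, h1, h2⟩
  · apply hdrop i
    simp [← hi]
  · exact hdrop i (ae_ang_add_ang_of_spike hq h1 h2)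
  -- Numbering from `i + 1` turns side `i` into the closing side and gives side `j` some number
  -- `j'`. Nonadjacency means `0 < j' < m`, and this is exactly what makes both pieces, with `j' +
  -- 2` and `m - j' + 2` vertices, smaller than `m + 2`.
  · have hen := relaxedEnergy_unroll η x (i + 1)
    have hi := unroll_val_sub x (i + 1) i
    have hilast : (i - (i + 1) : Fin (m + 2)).val = m + 1 := by
      have : i - (i + 1) = Fin.last (m + 1) := by
        rw [sub_eq_iff_eq_add]
        calc i = i + 0 := (add_zero i).symm
          _ = Fin.last (m + 1) + (i + 1) := by rw [← Fin.last_add_one (m + 1)]; abel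
      rw [this, Fin.val_last]
    rw [hilast] at hi
    have hj := unroll_val_sub x (i + 1) j
    have hj' := unroll_val_sub_succ x (i + 1) j
    have hj0 : (j - (i + 1) : Fin (m + 2)).val ≠ 0 := by
      intro h0
      exact hij' (sub_eq_zero.mp (Fin.ext h0)).symm
    have hjlast : (j - (i + 1) : Fin (m + 2)).val ≠ m + 1 := by
      intro h0
      exact hij (sub_left_injective (Fin.ext (hilast.trans h0.symm)))
    have hjlast' : (j - (i + 1) : Fin (m + 2)).val ≠ m := by
      intro h0
      have : j + 1 - (i + 1) = i - (i + 1) := by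
        rw [add_sub_right_comm]
        ext
        rw [hilast, Fin.val_add, h0]
        simp
      exact hji (sub_left_injective this)
    have hjlt := (j - (i + 1) : Fin (m + 2)).is_lt
    generalize (j - (i + 1) : Fin (m + 2)).val = j' at *
    obtain ⟨k, hk⟩ : ∃ k, m = j' + k := ⟨m - j', by omega⟩
    subst hk
    rw [← hi, ← unroll_zero x (i + 1)] at h1
    rw [← hj, ← hj'] at h2
    obtain ⟨g, hg | hg⟩ := relaxedEnergy_le_of_cut hc (by rwa [hen]) h2 h1
    · exact step (j' + 2) (by omega) _ (hen ▸ hg)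
    · exact step (k + 2) (by omega) _ (hen ▸ hg)

/-! ### Subdivision of simple polygons -/

/-- The segment from `a` to `b` without its end point `b` (if `a ≠ b`). -/
def halfOpenSegment (a b : Plane) : Set Plane := (fun t : ℝ => AffineMap.lineMap a b t) '' Set.Ico 0 1

lemma left_mem_halfOpenSegment (a b : Plane) : a ∈ halfOpenSegment a b :=
  ⟨0, by simp, by simp⟩

lemma halfOpenSegment_subset (a b : Plane) : halfOpenSegment a b ⊆ segment ℝ a b := by
  rintro _ ⟨t, ht, rfl⟩
  exact lineMap_mem_segment a b ⟨ht.1, ht.2.le⟩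

lemma right_notMem_halfOpenSegment {a b : Plane} (h : a ≠ b) : b ∉ halfOpenSegment a b := by
  rintro ⟨t, ht, hb⟩
  have := (AffineMap.lineMap_injective ℝ h) (hb.trans (AffineMap.lineMap_apply_one a b).symm)
  exact ht.2.ne this

lemma mem_halfOpenSegment_or_eq {a b q : Plane} (h : q ∈ segment ℝ a b) :
    q ∈ halfOpenSegment a b ∨ q = b := by
  rw [segment_eq_image_lineMap] at h
  obtain ⟨t, ht, rfl⟩ := h
  rcases ht.2.lt_or_eq with h1 | rfl
  · exact Or.inl ⟨t, ⟨ht.1, h1⟩, rfl⟩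
  · exact Or.inr (AffineMap.lineMap_apply_one a b)

/-- A polygon is simple if and only if its half-open sides are pairwise disjoint. -/
lemma isSimple_iff {m : ℕ} (hm : 2 ≤ m) {x : Polygon Plane (m + 1)} :
    IsSimple x ↔ ∀ i j, i ≠ j → ∀ q, q ∈ halfOpenSegment (x i) (x (i + 1)) →
      q ∉ halfOpenSegment (x j) (x (j + 1)) := by
  -- With at least three sides, the next side and the one after it both differ from the given side.
  have hval : (1 : Fin (m + 1)).val = 1 := by
    rw [Fin.val_one', Nat.mod_eq_of_lt (by omega)]
  have hone : (1 : Fin (m + 1)) ≠ 0 := by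
    rw [Ne, Fin.ext_iff, hval, Fin.val_zero]
    omega
  have htwo : (1 : Fin (m + 1)) + 1 ≠ 0 := by
    rw [Ne, Fin.ext_iff, Fin.val_add, hval, Fin.val_zero, Nat.mod_eq_of_lt (by omega)]
    omega
  constructor
  · intro h
    have hadj : ∀ i q, q ∈ halfOpenSegment (x i) (x (i + 1)) →
        q ∉ halfOpenSegment (x (i + 1)) (x (i + 1 + 1)) := by
      intro i q hi hj
      have h1 := h.adjacent i
      simp only [edgeSet_eq_segment, finRotate_apply] at h1
      have hq : q = x (i + 1) :=
        h1.subset ⟨halfOpenSegment_subset _ _ hi, halfOpenSegment_subset _ _ hj⟩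
      rw [hq] at hi
      have h2 := h.nondegenerate i
      rw [finRotate_apply] at h2
      exact right_notMem_halfOpenSegment h2 hi
    intro i j hij q hi hj
    rcases eq_or_ne (i + 1) j with rfl | hij'
    · exact hadj i q hi hj
    rcases eq_or_ne (j + 1) i with rfl | hji
    · exact hadj j q hj hi
    have h1 := h.nonadjacent i j hij
    simp only [edgeSet_eq_segment, finRotate_apply] at h1
    exact Set.disjoint_left.mp (h1 hij' hji) (halfOpenSegment_subset _ _ hi)
      (halfOpenSegment_subset _ _ hj)
  · intro h
    have hmem : ∀ i q, q ∈ segment ℝ (x i) (x (i + 1)) →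
        ∃ k, (k = i ∨ k = i + 1) ∧ q ∈ halfOpenSegment (x k) (x (k + 1)) := by
      intro i q hq
      rcases mem_halfOpenSegment_or_eq hq with h1 | rfl
      · exact ⟨i, Or.inl rfl, h1⟩
      · exact ⟨i + 1, Or.inr rfl, left_mem_halfOpenSegment _ _⟩
    refine ⟨fun i => ?_, fun i => ?_, fun i j hij hij' hji => ?_⟩
    · rw [finRotate_apply]
      intro heq
      refine h i (i + 1) (by simpa using hone) _ (left_mem_halfOpenSegment _ _) ?_
      rw [heq]
      exact left_mem_halfOpenSegment _ _
    · simp only [edgeSet_eq_segment, finRotate_apply]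
      refine Set.Subset.antisymm (fun q hq => ?_) ?_
      · rcases mem_halfOpenSegment_or_eq hq.1 with h1 | h1
        · obtain ⟨k, hk, hqk⟩ := hmem _ q hq.2
          refine absurd hqk (h i k ?_ q h1)
          rcases hk with rfl | rfl
          · simpa using hone
          · rw [add_assoc]
            simpa using htwo
        · exact h1
      · rw [Set.singleton_subset_iff]
        exact ⟨right_mem_segment ℝ _ _, left_mem_segment ℝ _ _⟩
    · simp only [edgeSet_eq_segment, finRotate_apply] at hij' hji ⊢
      rw [Set.disjoint_left]
      intro q hi hj
      obtain ⟨k, hk, hqk⟩ := hmem i q hi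
      obtain ⟨l, hl, hql⟩ := hmem j q hj
      refine h k l ?_ q hqk hql
      rcases hk with rfl | rfl <;> rcases hl with rfl | rfl
      · exact hij
      · exact hji.symm
      · exact hij'
      · simpa using hij

/-- Adding the midpoint of the last side as a vertex. -/
def subdivide {m : ℕ} (x : Polygon Plane (m + 1)) : ℕ → Plane := fun i =>
  if h : i < m + 1 then x ⟨i, h⟩ else AffineMap.lineMap (x (Fin.last m)) (x 0) (2⁻¹ : ℝ)

lemma edgeSum_subdivide {Φ : Plane → Plane → ℝ} {m : ℕ} {x : Polygon Plane (m + 1)}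
    (h : Φ (x (Fin.last m)) (AffineMap.lineMap (x (Fin.last m)) (x 0) (2⁻¹ : ℝ)) +
      Φ (AffineMap.lineMap (x (Fin.last m)) (x 0) (2⁻¹ : ℝ)) (x 0) = Φ (x (Fin.last m)) (x 0)) :
    edgeSum Φ (ofFun (subdivide x) (m + 2)) = edgeSum Φ x := by
  have hx : x = ofFun (subdivide x) (m + 1) := by
    cases x
    simp [ofFun, subdivide, Nat.le_of_lt_succ (Fin.is_lt _)]
  have h0 : subdivide x 0 = x 0 := by simp [subdivide]
  have h1 : subdivide x m = x (Fin.last m) := by simp [subdivide, Fin.last]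
  have h2 : subdivide x (m + 1) = AffineMap.lineMap (x (Fin.last m)) (x 0) (2⁻¹ : ℝ) := by
    simp [subdivide]
  conv_rhs => rw [hx]
  rw [edgeSum_ofFun, edgeSum_ofFun, Finset.sum_range_succ, h0, h1, h2, add_assoc, h]

lemma lineMap_half_mem (a b : Plane) : AffineMap.lineMap a b (2⁻¹ : ℝ) ∈ segment ℝ a b :=
  lineMap_mem_segment a b (by norm_num)

lemma length_subdivide {m : ℕ} (x : Polygon Plane (m + 1)) :
    length (ofFun (subdivide x) (m + 2)) = length x := by
  apply edgeSum_subdivide (Φ := fun a b => ‖b - a‖)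
  simpa [dist_eq_norm_sub'] using
    dist_add_dist_of_mem_segment (lineMap_half_mem (x (Fin.last m)) (x 0))

lemma relaxedArea_subdivide (η : Plane → ℝ) {m : ℕ} (x : Polygon Plane (m + 1)) :
    relaxedArea η (ofFun (subdivide x) (m + 2)) = relaxedArea η x := by
  apply relaxedArea_congr
  filter_upwards [ae_notMem_segment (x (Fin.last m)) (x 0)] with y hy
  apply edgeSum_subdivide
  exact ang_add_ang_of_mem hy (left_mem_segment ℝ _ _) (lineMap_half_mem _ _)
    (right_mem_segment ℝ _ _)

lemma halfOpenSegment_lineMap_subset_left (a b : Plane) :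
    halfOpenSegment a (AffineMap.lineMap a b (2⁻¹ : ℝ)) ⊆
      (fun t : ℝ => AffineMap.lineMap a b t) '' Set.Ico 0 2⁻¹ := by
  rintro _ ⟨t, ht, rfl⟩
  refine ⟨t / 2, ⟨by linarith [ht.1], by linarith [ht.2]⟩, ?_⟩
  simp only [AffineMap.lineMap_apply_module']
  module

lemma halfOpenSegment_lineMap_subset_right (a b : Plane) :
    halfOpenSegment (AffineMap.lineMap a b (2⁻¹ : ℝ)) b ⊆
      (fun t : ℝ => AffineMap.lineMap a b t) '' Set.Ico 2⁻¹ 1 := by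
  rintro _ ⟨t, ht, rfl⟩
  refine ⟨(t + 1) / 2, ⟨by linarith [ht.1], by linarith [ht.2]⟩, ?_⟩
  simp only [AffineMap.lineMap_apply_module']
  module

/-- The map `π` sends a new side to the old side containing it, so disjointness of half-open sides
is inherited. Only the two halves of the last side share an image, and they use the disjoint
parameter ranges `[0, 1/2)` and `[1/2, 1)`. -/
lemma isSimple_subdivide {m : ℕ} (hm : 2 ≤ m) {x : Polygon Plane (m + 1)} (hx : IsSimple x) :
    IsSimple (ofFun (subdivide x) (m + 2)) := by
  have hne : x (Fin.last m) ≠ x 0 := by simpa using hx.nondegenerate (Fin.last m)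
  rw [isSimple_iff hm] at hx
  rw [isSimple_iff (by omega)]
  let π : Fin (m + 2) → Fin (m + 1) := fun i => ⟨min i m, by omega⟩
  have hπ : ∀ i : Fin (m + 2),
      (i.val < m → halfOpenSegment (ofFun (subdivide x) (m + 2) i)
        (ofFun (subdivide x) (m + 2) (i + 1)) = halfOpenSegment (x (π i)) (x (π i + 1))) ∧
      (i.val = m → halfOpenSegment (ofFun (subdivide x) (m + 2) i)
        (ofFun (subdivide x) (m + 2) (i + 1)) ⊆ (fun t : ℝ => AffineMap.lineMap
          (x (Fin.last m)) (x 0) t) '' Set.Ico 0 2⁻¹) ∧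
      (i.val = m + 1 → halfOpenSegment (ofFun (subdivide x) (m + 2) i)
        (ofFun (subdivide x) (m + 2) (i + 1)) ⊆ (fun t : ℝ => AffineMap.lineMap
          (x (Fin.last m)) (x 0) t) '' Set.Ico 2⁻¹ 1) := by
    intro i
    refine ⟨fun hi => ?_, fun hi => ?_, fun hi => ?_⟩
    · have h1 : (i + 1 : Fin (m + 2)).val = i.val + 1 := by
        rw [Fin.val_add_one_of_lt']; omega
      have h2 : (π i + 1 : Fin (m + 1)) = ⟨i.val + 1, by omega⟩ := by
        ext
        rw [Fin.val_add_one_of_lt'] <;> simp only [π] <;> omega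
      have h3 : π i = ⟨i.val, by omega⟩ := by
        ext
        simp only [π]; omega
      rw [h2, h3]
      simp only [ofFun, h1, subdivide]
      rw [dif_pos (by omega), dif_pos (by omega)]
    · have h1 : (i + 1 : Fin (m + 2)).val = m + 1 := by
        rw [Fin.val_add_one_of_lt'] <;> omega
      simp only [ofFun, h1, subdivide, hi]
      rw [dif_pos (by omega), dif_neg (by omega)]
      exact halfOpenSegment_lineMap_subset_left _ _
    · have h1 : (i + 1 : Fin (m + 2)) = 0 := by
        have : i = Fin.last (m + 1) := Fin.ext hi
        rw [this, Fin.last_add_one]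
      simp only [ofFun, h1, subdivide, hi]
      rw [dif_neg (by omega), dif_pos (by simp)]
      exact halfOpenSegment_lineMap_subset_right _ _
  have hsub : ∀ i : Fin (m + 2), halfOpenSegment (ofFun (subdivide x) (m + 2) i)
        (ofFun (subdivide x) (m + 2) (i + 1)) ⊆ halfOpenSegment (x (π i)) (x (π i + 1)) := by
    intro i
    rcases lt_or_ge i.val m with hi | hi
    · exact ((hπ i).1 hi).subset
    · have h1 : π i = Fin.last m := by
        ext
        simp only [π, Fin.val_last]; omega
      rw [h1, Fin.last_add_one]
      have hi' : i.val = m ∨ i.val = m + 1 := by omega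
      rcases hi' with hi' | hi'
      · exact ((hπ i).2.1 hi').trans
          (Set.image_mono (Set.Ico_subset_Ico_right (by norm_num)))
      · exact ((hπ i).2.2 hi').trans
          (Set.image_mono (Set.Ico_subset_Ico_left (by norm_num)))
  have hlast : ∀ i j : Fin (m + 2), i.val = m → j.val = m + 1 → ∀ q,
      q ∈ halfOpenSegment (ofFun (subdivide x) (m + 2) i) (ofFun (subdivide x) (m + 2) (i + 1)) →
      q ∉ halfOpenSegment (ofFun (subdivide x) (m + 2) j)
        (ofFun (subdivide x) (m + 2) (j + 1)) := by
    intro i j hi hj q hqi hqj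
    obtain ⟨s, hs, hsq⟩ := (hπ i).2.1 hi hqi
    obtain ⟨t, ht, htq⟩ := (hπ j).2.2 hj hqj
    have := AffineMap.lineMap_injective ℝ hne (hsq.trans htq.symm)
    linarith [hs.2, ht.1]
  intro i j hij q hi hj
  by_cases hπij : π i = π j
  · have h1 : min i.val m = min j.val m := congrArg Fin.val hπij
    have h2 : i.val ≠ j.val := fun h => hij (Fin.ext h)
    have h3 : (i.val = m ∧ j.val = m + 1) ∨ (j.val = m ∧ i.val = m + 1) := by omega
    rcases h3 with ⟨h, h'⟩ | ⟨h, h'⟩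
    · exact hlast i j h h' q hi hj
    · exact hlast j i h h' q hj hi
  · exact hx _ _ hπij q (hsub i hi) (hsub j hj)

/-- Simplicity permits straight angles, so midpoints can be inserted until there are `n` vertices.
Polygons with different numbers of sides can thus be compared within the space of `n`-tuples. -/
lemma exists_isSimple_of_le {m n : ℕ} (hm : 3 ≤ m) (hmn : m ≤ n) {x : Polygon Plane m}
    (hx : IsSimple x) : ∃ y : Polygon Plane n, IsSimple y ∧ length y = length x ∧
      ∀ η, relaxedArea η y = relaxedArea η x := by
  induction n, hmn using Nat.le_induction with
  | base => exact ⟨x, hx, rfl, fun _ => rfl⟩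
  | succ n hmn ih =>
    obtain ⟨y, hy, hl, hA⟩ := ih
    obtain ⟨k, rfl⟩ : ∃ k, n = k + 1 := ⟨n - 1, by omega⟩
    exact ⟨_, isSimple_subdivide (by omega) hy, (length_subdivide y).trans hl,
      fun η => (relaxedArea_subdivide η y).trans (hA η)⟩

lemma exists_isSimple {n : ℕ} (hn : 3 ≤ n) : ∃ x : Polygon Plane n, IsSimple x := by
  suffices h : ∃ x : Polygon Plane 3, IsSimple x by
    obtain ⟨x, hx⟩ := h
    obtain ⟨y, hy, -⟩ := exists_isSimple_of_le le_rfl hn hx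
    exact ⟨y, hy⟩
  refine ⟨⟨![!₂[0, 0], !₂[1, 0], !₂[0, 1]]⟩, (isSimple_iff (m := 2) le_rfl).mpr ?_⟩
  have key : ∀ q : Plane,
      (q ∈ halfOpenSegment (!₂[0, 0] : Plane) !₂[1, 0] → q 0 < 1 ∧ q 1 = 0) ∧
      (q ∈ halfOpenSegment (!₂[1, 0] : Plane) !₂[0, 1] → 0 < q 0 ∧ q 0 + q 1 = 1) ∧
      (q ∈ halfOpenSegment (!₂[0, 1] : Plane) !₂[0, 0] → q 0 = 0 ∧ 0 < q 1) := by
    intro q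
    refine ⟨?_, ?_, ?_⟩ <;> rintro ⟨t, ⟨ht0, ht1⟩, rfl⟩ <;>
      simp [AffineMap.lineMap_apply_module'] <;> linarith
  intro i j hij q hi hj
  obtain ⟨h0, h1, h2⟩ := key q
  fin_cases i <;> fin_cases j <;> simp at hij hi hj <;>
    first
    | (have a := h0 hi; have b := h1 hj; linarith [a.1, a.2, b.1, b.2])
    | (have a := h0 hi; have b := h2 hj; linarith [a.1, a.2, b.1, b.2])
    | (have a := h1 hi; have b := h0 hj; linarith [a.1, a.2, b.1, b.2])
    | (have a := h1 hi; have b := h2 hj; linarith [a.1, a.2, b.1, b.2])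
    | (have a := h2 hi; have b := h0 hj; linarith [a.1, a.2, b.1, b.2])
    | (have a := h2 hi; have b := h1 hj; linarith [a.1, a.2, b.1, b.2])

/-! ### Existence of maximizers of the relaxed energy -/

lemma continuous_length {m : ℕ} : Continuous fun x : Fin m → Plane => length ⟨x⟩ := by
  unfold length
  fun_prop

/-- Dominated convergence: for `y` off the limit curve, hence almost everywhere, the winding number
around `y` depends continuously on the vertices, and nearby curves share a ball outside which their
winding numbers vanish. -/
lemma continuous_relaxedArea {η : Plane → ℝ} (hc : Continuous η) {m : ℕ} :
    Continuous fun x : Fin (m + 1) → Plane => relaxedArea η ⟨x⟩ := by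
  simp_rw [relaxedArea_eq]
  rw [continuous_iff_continuousAt]
  intro x
  have hcont : Continuous fun x : Fin (m + 1) → Plane => dist (x 0) 0 + length ⟨x⟩ :=
    ((continuous_apply 0).dist continuous_const).add continuous_length
  have hev : ∀ᶠ x' in nhds x, dist (x' 0) 0 + length ⟨x'⟩ ≤ dist (x 0) 0 + length ⟨x⟩ + 1 :=
    (hcont.continuousAt.eventually_lt continuousAt_const (by linarith)).mono fun _ h => h.le
  refine continuousAt_of_dominated (bound := (Metric.closedBall 0
    (dist (x 0) 0 + length ⟨x⟩ + 1)).indicator fun y => ((m + 1 : ℕ) : ℝ) / 2 * |η y|) ?_ ?_ ?_ ?_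
  · exact Filter.Eventually.of_forall fun x' =>
      (hc.measurable.mul (measurable_wind _)).aestronglyMeasurable
  · filter_upwards [hev] with x' hx'
    exact Filter.Eventually.of_forall (norm_mul_wind_le η ⟨x'⟩ 0 0 hx')
  · exact integrable_indicator_closedBall hc _ _ _
  · filter_upwards [ae_notMem_boundary ⟨x⟩] with y hy
    exact continuousAt_const.mul ((continuousAt_wind hy).comp
      (f := fun x' : Fin (m + 1) → Plane => (x', y)) (by fun_prop))

lemma exists_setIntegral_sq_lt {η : Plane → ℝ} (hη : MemLp η 2 volume) {ε : ℝ} (hε : 0 < ε) :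
    ∃ R : ℝ, 0 ≤ R ∧ ∫ y in (Metric.closedBall (0 : Plane) R)ᶜ, η y ^ 2 < ε := by
  have hint : Integrable fun y => η y ^ 2 := hη.integrable_sq
  have hanti : Antitone fun k : ℕ => (Metric.closedBall (0 : Plane) k)ᶜ := fun k l hkl =>
    Set.compl_subset_compl.mpr (Metric.closedBall_subset_closedBall (by exact_mod_cast hkl))
  have h := tendsto_setIntegral_of_antitone
    (fun k : ℕ => (measurableSet_closedBall (x := (0 : Plane)) (ε := k)).compl) hanti
    ⟨0, hint.integrableOn⟩
  have hempty : ⋂ k : ℕ, (Metric.closedBall (0 : Plane) k)ᶜ = ∅ := by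
    rw [← Set.compl_iUnion, Metric.iUnion_closedBall_nat, Set.compl_univ]
  rw [hempty, setIntegral_empty] at h
  obtain ⟨k, hk⟩ := (h.eventually_lt_const hε).exists
  exact ⟨k, k.cast_nonneg, hk⟩

lemma volume_real_closedBall (c : Plane) {r : ℝ} (hr : 0 ≤ r) :
    volume.real (Metric.closedBall c r) = r ^ 2 * volume.real (Metric.ball (0 : Plane) 1) := by
  rw [Measure.addHaar_real_closedBall _ _ hr]
  simp

/-- A Cauchy-Schwarz type bound for the integral over a part of a disc. -/
lemma setIntegral_abs_le {η : Plane → ℝ} (hη : MemLp η 2 volume) {S T : Set Plane} {c : Plane}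
    {r ε : ℝ} (hr : 0 < r) (hε : 0 < ε) (hSr : S ⊆ Metric.closedBall c r)
    (hST : S ⊆ T) (hle : ∫ y in T, η y ^ 2 ≤ ε ^ 2) :
    ∫ y in S, |η y| ≤ (volume.real (Metric.ball (0 : Plane) 1) + 1) / 2 * ε * r := by
  have hint : Integrable fun y => η y ^ 2 := hη.integrable_sq
  have hfin : volume S ≠ ⊤ := (measure_mono hSr).trans_lt measure_closedBall_lt_top |>.ne
  -- Weighted AM-GM, with weights such that both terms become multiples of `ε r` when integrated
  -- over a set of area of order `r ^ 2`.
  have hpt : ∀ y, |η y| ≤ ε / (2 * r) + r / (2 * ε) * η y ^ 2 := by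
    intro y
    have h1 : ε / (2 * r) + r / (2 * ε) * η y ^ 2 - |η y| =
        (ε - r * |η y|) ^ 2 / (2 * r * ε) := by
      rw [← sq_abs (η y)]
      field_simp
      ring
    have : 0 ≤ (ε - r * |η y|) ^ 2 / (2 * r * ε) := by positivity
    linarith
  have hconst : IntegrableOn (fun _ : Plane => ε / (2 * r)) S := integrableOn_const hfin
  calc ∫ y in S, |η y| ≤ ∫ y in S, (ε / (2 * r) + r / (2 * ε) * η y ^ 2) := by
        refine integral_mono_of_nonneg (Filter.Eventually.of_forall fun y => abs_nonneg _)
          (hconst.add (hint.const_mul _).integrableOn) (Filter.Eventually.of_forall hpt)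
    _ = volume.real S * (ε / (2 * r)) + r / (2 * ε) * ∫ y in S, η y ^ 2 := by
        rw [integral_add hconst (hint.const_mul _).integrableOn, setIntegral_const,
          integral_const_mul, smul_eq_mul]
    _ ≤ r ^ 2 * volume.real (Metric.ball (0 : Plane) 1) * (ε / (2 * r)) +
          r / (2 * ε) * ε ^ 2 := by
        have h1 : volume.real S ≤ r ^ 2 * volume.real (Metric.ball (0 : Plane) 1) := by
          rw [← volume_real_closedBall c hr.le]
          exact measureReal_mono hSr measure_closedBall_lt_top.ne
        have h2 : ∫ y in S, η y ^ 2 ≤ ε ^ 2 :=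
          (setIntegral_mono_set hint.integrableOn
            (Filter.Eventually.of_forall fun y => sq_nonneg _)
            (Filter.Eventually.of_forall hST)).trans hle
        gcongr
    _ = (volume.real (Metric.ball (0 : Plane) 1) + 1) / 2 * ε * r := by
        field_simp

/-- The closed polygonal curves with energy at least `c > 0` have length bounded from above and
below, and lie in a fixed disc. -/
lemma exists_bounds_of_le_relaxedEnergy {η : Plane → ℝ} (hη : MemLp η 2 volume)
    (hc : Continuous η) (m : ℕ) {c : ℝ} (hcpos : 0 < c) :
    ∃ δ R : ℝ, 0 < δ ∧ ∀ x : Polygon Plane (m + 1), c ≤ relaxedEnergy η x →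
      δ ≤ length x ∧ ∀ i, x i ∈ Metric.closedBall 0 R := by
  set κ := volume.real (Metric.ball (0 : Plane) 1)
  have hκ : 0 ≤ κ := measureReal_nonneg
  set M : ℝ := ((m + 1 : ℕ) : ℝ) / 2
  have hM : 0 < M := by positivity
  -- With this `ε`, the part of `η` outside the ball of radius `R` contributes at most `c / 2` times
  -- the length to the area bound, that is, half of what the energy bound demands.
  set ε : ℝ := c / 2 / (M * ((κ + 1) / 2))
  have hε : 0 < ε := by positivity
  have hMε : M * ((κ + 1) / 2 * ε) = c / 2 := by
    simp only [ε]
    field_simp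
  obtain ⟨R, hR0, hR⟩ := exists_setIntegral_sq_lt hη (pow_pos hε 2)
  have hint : ∀ (a : Plane) (r : ℝ), IntegrableOn (fun y => |η y|) (Metric.closedBall a r) :=
    fun a r => hc.abs.continuousOn.integrableOn_compact (isCompact_closedBall a r)
  set I : ℝ := ∫ y in Metric.closedBall (0 : Plane) R, |η y|
  have hI : 0 ≤ I := integral_nonneg fun _ => abs_nonneg _
  -- The length bound that results from `c L ≤ M I + (c / 2) L`.
  set D : ℝ := 2 * M * I / c
  have hD : 0 ≤ D := by positivity
  obtain ⟨H, hH⟩ := (isCompact_closedBall (0 : Plane) (R + 2 * D)).exists_bound_of_continuousOn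
    hc.continuousOn
  have htail : ∀ (a : Plane) (r : ℝ), 0 < r →
      ∫ y in Metric.closedBall a r \ Metric.closedBall 0 R, |η y| ≤ (κ + 1) / 2 * ε * r :=
    fun a r hr => setIntegral_abs_le hη hr hε Set.sdiff_subset (fun y hy => hy.2) hR.le
  refine ⟨c / (M * (|H| + 1) * (κ + 1)), R + 2 * D, by positivity, fun x hx => ?_⟩
  have hL : 0 < length x := length_pos_of_relaxedEnergy_pos (hcpos.trans_le hx)
  have hcL : c * length x ≤ |relaxedArea η x| := by
    rwa [relaxedEnergy, le_div_iff₀ hL] at hx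
  have hA := hcL.trans (abs_relaxedArea_le hc x 0)
  have hLD : length x ≤ D := by
    have h1 : ∫ y in Metric.closedBall (x 0) (length x), |η y| ≤
        I + (κ + 1) / 2 * ε * length x := by
      rw [← integral_inter_add_sdiff (s := Metric.closedBall (x 0) (length x))
        (t := Metric.closedBall (0 : Plane) R) measurableSet_closedBall (hint _ _)]
      refine add_le_add ?_ (htail _ _ hL)
      exact setIntegral_mono_set (hint _ _) (Filter.Eventually.of_forall fun _ => abs_nonneg _)
        (Filter.Eventually.of_forall Set.inter_subset_right)
    have h2 : c * length x ≤ M * (I + (κ + 1) / 2 * ε * length x) :=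
      hA.trans (mul_le_mul_of_nonneg_left h1 hM.le)
    have h3 : M * (I + (κ + 1) / 2 * ε * length x) = M * I + c / 2 * length x := by
      rw [← hMε]; ring
    rw [h3] at h2
    rw [le_div_iff₀ hcpos]
    linarith
  -- Otherwise the disc carrying the winding number avoids the ball of radius `R`, only the tail
  -- contributes, and `c L ≤ (c / 2) L` is absurd.
  have hx0 : dist (x 0) 0 ≤ R + D := by
    by_contra! hlt
    have h1 : Metric.closedBall (x 0) (length x) \ Metric.closedBall 0 R =
        Metric.closedBall (x 0) (length x) := by
      rw [sdiff_eq_left]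
      apply Metric.closedBall_disjoint_closedBall
      linarith
    have h2 := htail (x 0) _ hL
    rw [h1] at h2
    have h3 : c * length x ≤ M * ((κ + 1) / 2 * ε * length x) :=
      hA.trans (mul_le_mul_of_nonneg_left h2 hM.le)
    have h4 : M * ((κ + 1) / 2 * ε * length x) = c / 2 * length x := by
      rw [← hMε]; ring
    rw [h4] at h3
    have := mul_pos hcpos hL
    linarith
  constructor
  -- Where `η` is bounded the area is at most quadratic in the length, while it must be at least `c`
  -- times the length, so the length cannot be small.
  · have hsub : Metric.closedBall (x 0) (length x) ⊆ Metric.closedBall 0 (R + 2 * D) :=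
      Metric.closedBall_subset_closedBall' (by linarith)
    have h1 : ∫ y in Metric.closedBall (x 0) (length x), |η y| ≤
        |H| * (length x ^ 2 * κ) := by
      rw [← volume_real_closedBall (x 0) hL.le]
      refine (Real.le_norm_self _).trans ?_
      refine norm_setIntegral_le_of_norm_le_const measure_closedBall_lt_top fun y hy => ?_
      rw [Real.norm_eq_abs, abs_abs]
      exact (hH y (hsub hy)).trans (le_abs_self H)
    have h2 : c * length x ≤ M * (|H| * (length x ^ 2 * κ)) :=
      hA.trans (mul_le_mul_of_nonneg_left h1 hM.le)
    have h3 : c ≤ M * |H| * κ * length x := by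
      refine le_of_mul_le_mul_right ?_ hL
      linarith
    have h4 : M * |H| * κ * length x ≤ M * (|H| + 1) * (κ + 1) * length x := by
      gcongr <;> linarith
    rw [div_le_iff₀ (by positivity)]
    linarith
  · intro i
    rw [Metric.mem_closedBall]
    linarith [dist_triangle (x i) (x 0) 0, dist_vertices_le x i 0]

/-- Direct method: every competitor at least as good as `x₀` lies in a compact set of vertex tuples
on which the length stays away from zero, so that the quotient is continuous. -/
theorem exists_forall_relaxedEnergy_le {η : Plane → ℝ} (hη : MemLp η 2 volume)
    (hc : Continuous η) {m : ℕ} {x₀ : Polygon Plane (m + 1)} (hx₀ : 0 < relaxedEnergy η x₀) :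
    ∃ x : Polygon Plane (m + 1), 0 < relaxedEnergy η x ∧
      ∀ z : Polygon Plane (m + 1), relaxedEnergy η z ≤ relaxedEnergy η x := by
  obtain ⟨δ, R, hδ, hb⟩ := exists_bounds_of_le_relaxedEnergy hη hc m hx₀
  set K : Set (Fin (m + 1) → Plane) :=
    Set.univ.pi (fun _ => Metric.closedBall 0 R) ∩ {x | δ ≤ length ⟨x⟩} with hK
  have hKc : IsCompact K := (isCompact_univ_pi fun _ => isCompact_closedBall _ _).inter_right
    (isClosed_le continuous_const continuous_length)
  have hmem : ∀ x : Polygon Plane (m + 1), relaxedEnergy η x₀ ≤ relaxedEnergy η x →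
      x.vertices ∈ K := fun x hx => ⟨fun i _ => (hb x hx).2 i, (hb x hx).1⟩
  have hcont : ContinuousOn (fun x : Fin (m + 1) → Plane => relaxedEnergy η ⟨x⟩) K := by
    unfold relaxedEnergy
    exact (continuous_relaxedArea hc).abs.continuousOn.div continuous_length.continuousOn
      fun x hx => (hδ.trans_le hx.2).ne'
  obtain ⟨x, hxK, hx⟩ := hKc.exists_isMaxOn ⟨_, hmem x₀ le_rfl⟩ hcont
  have h0 : relaxedEnergy η x₀ ≤ relaxedEnergy η ⟨x⟩ := hx (hmem x₀ le_rfl)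
  refine ⟨⟨x⟩, hx₀.trans_le h0, fun z => ?_⟩
  rcases le_total (relaxedEnergy η x₀) (relaxedEnergy η z) with h | h
  · exact hx (hmem z h)
  · exact h.trans h0

/-- The relaxed energy has a maximizer that is a simple polygon. -/
theorem exists_isSimple_forall_relaxedEnergy_le {η : Plane → ℝ} (hη : MemLp η 2 volume)
    (hc : Continuous η) {n : ℕ} (hn : 3 ≤ n) :
    ∃ x : Polygon Plane n, IsSimple x ∧
      ∀ z : Polygon Plane n, relaxedEnergy η z ≤ relaxedEnergy η x := by
  by_cases h : ∃ x₀ : Polygon Plane n, 0 < relaxedEnergy η x₀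
  · obtain ⟨x₀, hx₀⟩ := h
    obtain ⟨m, rfl⟩ : ∃ m, n = m + 1 := ⟨n - 1, by omega⟩
    obtain ⟨x, hxpos, hx⟩ := exists_forall_relaxedEnergy_le hη hc hx₀
    obtain ⟨k, hk, hkm, y, hy, hxy⟩ := exists_isSimple_relaxedEnergy_le hc _ x hxpos
    obtain ⟨z, hz, hl, hA⟩ := exists_isSimple_of_le hk hkm hy
    refine ⟨z, hz, fun w => (hx w).trans (hxy.trans_eq ?_)⟩
    rw [relaxedEnergy, relaxedEnergy, hl, hA]
  -- If the energy vanishes identically, any simple polygon is a maximizer.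
  · push Not at h
    obtain ⟨x, hx⟩ := exists_isSimple hn
    exact ⟨x, hx, fun z => (h z).trans (relaxedEnergy_nonneg η x)⟩

/-! ### Local structure of a simple closed polygonal curve -/

/-- Near `p`, the complement of `Γ` consists of (parts of) two connected sets `L` and `R`, both of
which accumulate at all points of `Γ` near `p`. -/
def IsTwoSidedAt (Γ : Set Plane) (p : Plane) (L R : Set Plane) : Prop :=
  IsPreconnected L ∧ IsPreconnected R ∧ L ⊆ Γᶜ ∧ R ⊆ Γᶜ ∧
    ∃ B ∈ nhds p, B \ Γ ⊆ L ∪ R ∧ Γ ∩ B ⊆ closure L ∧ Γ ∩ B ⊆ closure R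

lemma convex_cross_pos (v p : Plane) : Convex ℝ {y | 0 < cross v (y - p)} := by
  intro y hy z hz a b ha hb hab
  have h : a • y + b • z - p = a • (y - p) + b • (z - p) := by
    have : p = (a + b) • p := by rw [hab, one_smul]
    nth_rw 1 [this]
    module
  rw [Set.mem_ofPred_eq] at *
  rw [h, cross_add_right, cross_smul_right, cross_smul_right]
  rcases ha.eq_or_lt with rfl | ha
  · have : b = 1 := by linarith
    rw [this]
    linarith
  · have := mul_pos ha hy
    have := mul_nonneg hb hz.le
    linarith

lemma mem_closure_ball_inter {p y n : Plane} {r : ℝ} {S : Set Plane} (hy : y ∈ Metric.ball p r)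
    (h : ∀ t : ℝ, 0 < t → y + t • n ∈ S) : y ∈ closure (Metric.ball p r ∩ S) := by
  have ht : Filter.Tendsto (fun t : ℝ => y + t • n) (nhdsWithin 0 (Set.Ioi 0)) (nhds y) := by
    have : Continuous fun t : ℝ => y + t • n := by fun_prop
    simpa using (this.tendsto 0).mono_left nhdsWithin_le_nhds
  refine mem_closure_of_tendsto ht ?_
  filter_upwards [ht (Metric.isOpen_ball.mem_nhds hy), self_mem_nhdsWithin] with t h1 h2
  exact ⟨h1, h t h2⟩

lemma cross_neg_left (u v : Plane) : cross (-u) v = -cross u v := by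
  simp [cross]; ring

/-- The vector `u` rotated by a right angle. -/
def rotate (u : Plane) : Plane := !₂[-u 1, u 0]

lemma cross_rotate (u : Plane) : cross u (rotate u) = ‖u‖ ^ 2 := by
  rw [norm_sq_eq]
  simp [cross, rotate]
  ring

/-- The two sides are half-discs. Points of the line are reached from either half-disc by moving
along the normal `rotate u` or its opposite. -/
lemma isTwoSidedAt_of_line {Γ : Set Plane} {p u : Plane} {r : ℝ} (hr : 0 < r) (hu : u ≠ 0)
    (h : ∀ y ∈ Metric.ball p r, y ∈ Γ ↔ cross u (y - p) = 0) :
    IsTwoSidedAt Γ p (Metric.ball p r ∩ {y | 0 < cross u (y - p)})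
      (Metric.ball p r ∩ {y | 0 < cross (-u) (y - p)}) := by
  have hpos : 0 < ‖u‖ ^ 2 := by positivity
  refine ⟨((convex_ball p r).inter (convex_cross_pos u p)).isPreconnected,
    ((convex_ball p r).inter (convex_cross_pos (-u) p)).isPreconnected, ?_, ?_,
    Metric.ball p r, Metric.ball_mem_nhds p hr, ?_, ?_, ?_⟩
  · rintro y ⟨hy, hy'⟩ hyΓ
    exact hy'.ne' ((h y hy).mp hyΓ)
  · rintro y ⟨hy, hy'⟩ hyΓ
    have := (h y hy).mp hyΓ
    rw [Set.mem_ofPred_eq, cross_neg_left, this] at hy'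
    simp at hy'
  · rintro y ⟨hy, hyΓ⟩
    rcases lt_trichotomy (cross u (y - p)) 0 with h1 | h1 | h1
    · refine Or.inr ⟨hy, ?_⟩
      rw [Set.mem_ofPred_eq, cross_neg_left]
      linarith
    · exact absurd ((h y hy).mpr h1) hyΓ
    · exact Or.inl ⟨hy, h1⟩
  · rintro y ⟨hyΓ, hy⟩
    refine mem_closure_ball_inter (n := rotate u) hy fun t ht => ?_
    rw [Set.mem_ofPred_eq, add_sub_right_comm, cross_add_right, (h y hy).mp hyΓ, cross_smul_right,
      cross_rotate]
    positivity
  · rintro y ⟨hyΓ, hy⟩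
    refine mem_closure_ball_inter (n := -rotate u) hy fun t ht => ?_
    rw [Set.mem_ofPred_eq, add_sub_right_comm, cross_neg_left, cross_add_right, (h y hy).mp hyΓ,
      smul_neg, ← neg_smul, cross_smul_right, cross_rotate]
    have := mul_pos ht hpos
    linarith

lemma isTwoSidedAt_of_corner {Γ : Set Plane} {p u u' : Plane} {r : ℝ} (hr : 0 < r)
    (hu : cross u u' ≠ 0)
    (h : ∀ y ∈ Metric.ball p r, y ∈ Γ ↔
      (∃ s : ℝ, 0 ≤ s ∧ y = p + s • u) ∨ ∃ s : ℝ, 0 ≤ s ∧ y = p + s • u') :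
    ∃ L R, IsTwoSidedAt Γ p L R := by
  -- The vectors `v` and `w` give the coordinates `cross v (y - p)` and `cross w (y - p)` of `y` in
  -- the basis `u`, `u'` centred at `p`; in them the curve is the pair of nonnegative half-axes.
  obtain ⟨v, hv, hv'⟩ : ∃ v, cross v u = 1 ∧ cross v u' = 0 := by
    refine ⟨(-(cross u u')⁻¹) • u', ?_, ?_⟩
    · rw [cross_smul_left, cross_swap u' u]
      field_simp
    · rw [cross_smul_left, cross_self, mul_zero]
  obtain ⟨w, hw, hw'⟩ : ∃ w, cross w u = 0 ∧ cross w u' = 1 := by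
    refine ⟨(cross u u')⁻¹ • u, ?_, ?_⟩
    · rw [cross_smul_left, cross_self, mul_zero]
    · rw [cross_smul_left]
      field_simp
  have hdecomp : ∀ y, y = p + cross v (y - p) • u + cross w (y - p) • u' := by
    intro y
    have key : ∀ z : Plane, cross u u' • z = cross z u' • u + cross u z • u' := by
      intro z
      ext i
      fin_cases i <;> simp [cross] <;> ring
    have h1 := key (y - p)
    have h2 := congrArg (cross v) h1
    have h3 := congrArg (cross w) h1
    simp only [cross_smul_right, cross_add_right, hv, hv', hw, hw'] at h2 h3
    have h4 : cross u u' • (y - p) =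
        cross u u' • (cross v (y - p) • u + cross w (y - p) • u') := by
      rw [smul_add, smul_smul, smul_smul, h2, h3]
      simpa using h1
    have h5 := smul_right_injective _ hu h4
    rw [add_assoc, ← h5]
    abel
  have h' : ∀ y ∈ Metric.ball p r, y ∈ Γ ↔
      (cross w (y - p) = 0 ∧ 0 ≤ cross v (y - p)) ∨
        (cross v (y - p) = 0 ∧ 0 ≤ cross w (y - p)) := by
    intro y hy
    rw [h y hy]
    constructor
    · rintro (⟨s, hs, rfl⟩ | ⟨s, hs, rfl⟩)
      · left
        simp [cross_smul_right, hw, hv, hs]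
      · right
        simp [cross_smul_right, hw', hv', hs]
    · rintro (⟨h1, h2⟩ | ⟨h1, h2⟩)
      · refine Or.inl ⟨_, h2, ?_⟩
        have := hdecomp y
        rwa [h1, zero_smul, add_zero] at this
      · refine Or.inr ⟨_, h2, ?_⟩
        have := hdecomp y
        rwa [h1, zero_smul, add_zero] at this
  have hshift : ∀ (z y n : Plane) (t : ℝ),
      cross z (y + t • n - p) = cross z (y - p) + t * cross z n := by
    intro z y n t
    rw [add_sub_right_comm, cross_add_right, cross_smul_right]
  -- One side is the open quadrant, which is convex. The other is the reflex sector, connected as a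
  -- union of two convex half-discs that overlap in the direction `-(u + u')`.
  refine ⟨Metric.ball p r ∩ ({y | 0 < cross v (y - p)} ∩ {y | 0 < cross w (y - p)}),
    Metric.ball p r ∩ ({y | 0 < cross (-v) (y - p)} ∪ {y | 0 < cross (-w) (y - p)}),
    ((convex_ball p r).inter ((convex_cross_pos v p).inter (convex_cross_pos w p))).isPreconnected,
    ?_, ?_, ?_, Metric.ball p r, Metric.ball_mem_nhds p hr, ?_, ?_, ?_⟩
  · rw [Set.inter_union_distrib_left]
    have hne : (Metric.ball p r ∩
        ({y | 0 < cross (-v) (y - p)} ∩ {y | 0 < cross (-w) (y - p)})).Nonempty := by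
      rw [← closure_nonempty_iff]
      refine ⟨p, mem_closure_ball_inter (n := (-1 : ℝ) • (u + u')) (Metric.mem_ball_self hr)
        fun t ht => ⟨?_, ?_⟩⟩
      · simp only [Set.mem_ofPred_eq, hshift, cross_neg_left, cross_smul_right, cross_add_right,
          hv, hv']
        simp [cross, ht]
      · simp only [Set.mem_ofPred_eq, hshift, cross_neg_left, cross_smul_right, cross_add_right,
          hw, hw']
        simp [cross, ht]
    obtain ⟨q, hq, hq1, hq2⟩ := hne
    exact IsPreconnected.union q ⟨hq, hq1⟩ ⟨hq, hq2⟩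
      ((convex_ball p r).inter (convex_cross_pos (-v) p)).isPreconnected
      ((convex_ball p r).inter (convex_cross_pos (-w) p)).isPreconnected
  · rintro y ⟨hy, hy1, hy2⟩ hyΓ
    rw [Set.mem_ofPred_eq] at hy1 hy2
    rcases (h' y hy).mp hyΓ with ⟨h1, -⟩ | ⟨h1, -⟩ <;> linarith
  · rintro y ⟨hy, hy1⟩ hyΓ
    simp only [Set.mem_union, Set.mem_ofPred_eq, cross_neg_left] at hy1
    rcases (h' y hy).mp hyΓ with ⟨h1, h2⟩ | ⟨h1, h2⟩ <;> rcases hy1 with h3 | h3 <;> linarith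
  · rintro y ⟨hy, hyΓ⟩
    rw [h' y hy] at hyΓ
    by_cases h1 : 0 < cross v (y - p) ∧ 0 < cross w (y - p)
    · exact Or.inl ⟨hy, h1⟩
    · refine Or.inr ⟨hy, ?_⟩
      simp only [Set.mem_union, Set.mem_ofPred_eq, cross_neg_left]
      by_contra! hcon
      obtain ⟨h2, h3⟩ := hcon
      rcases (show 0 ≤ cross v (y - p) by linarith).eq_or_lt with h4 | h4
      · exact hyΓ (Or.inr ⟨h4.symm, by linarith⟩)
      · rcases (show 0 ≤ cross w (y - p) by linarith).eq_or_lt with h5 | h5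
        · exact hyΓ (Or.inl ⟨h5.symm, by linarith⟩)
        · exact h1 ⟨h4, h5⟩
  · rintro y ⟨hyΓ, hy⟩
    refine mem_closure_ball_inter (n := u + u') hy fun t ht => ?_
    simp only [Set.mem_inter_iff, Set.mem_ofPred_eq, hshift, cross_add_right, hv, hv', hw, hw']
    rcases (h' y hy).mp hyΓ with ⟨h1, h2⟩ | ⟨h1, h2⟩ <;> constructor <;> linarith
  · rintro y ⟨hyΓ, hy⟩
    rcases (h' y hy).mp hyΓ with ⟨h1, h2⟩ | ⟨h1, h2⟩
    · refine mem_closure_ball_inter (n := (-1 : ℝ) • u') hy fun t ht => Or.inr ?_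
      rw [Set.mem_ofPred_eq, hshift, cross_smul_right, cross_neg_left, cross_neg_left, h1, hw']
      linarith
    · refine mem_closure_ball_inter (n := (-1 : ℝ) • u) hy fun t ht => Or.inl ?_
      rw [Set.mem_ofPred_eq, hshift, cross_smul_right, cross_neg_left, cross_neg_left, h1, hv]
      linarith

lemma exists_eq_smul_of_cross_eq_zero {u z : Plane} (hu : u ≠ 0) (h : cross u z = 0) :
    ∃ s : ℝ, z = s • u := by
  have hpos : ‖u‖ ^ 2 ≠ 0 := by positivity
  refine ⟨(u 0 * z 0 + u 1 * z 1) / ‖u‖ ^ 2, ?_⟩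
  rw [norm_sq_eq] at *
  simp only [cross] at h
  ext i
  fin_cases i
  · simp
    field_simp
    linear_combination -u 1 * h
  · simp
    field_simp
    linear_combination u 0 * h

lemma mem_segment_iff_of_mem_ball_left {a b y : Plane} (hy : y ∈ Metric.ball a ‖b - a‖) :
    y ∈ segment ℝ a b ↔ ∃ s : ℝ, 0 ≤ s ∧ y = a + s • (b - a) := by
  rw [segment_eq_image_lineMap]
  constructor
  · rintro ⟨s, hs, rfl⟩
    exact ⟨s, hs.1, by rw [AffineMap.lineMap_apply_module', add_comm]⟩
  · rintro ⟨s, hs, rfl⟩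
    refine ⟨s, ⟨hs, ?_⟩, by rw [AffineMap.lineMap_apply_module', add_comm]⟩
    rw [Metric.mem_ball, dist_eq_norm, add_sub_cancel_left, norm_smul, Real.norm_eq_abs,
      abs_of_nonneg hs] at hy
    by_contra! h1
    nlinarith [norm_nonneg (b - a)]

/-- The radius is the distance to the nearer end point when the centre is interior, so inside the
ball the segment is indistinguishable from its line. -/
lemma mem_segment_iff_of_mem_ball {a b y : Plane} (hab : a ≠ b) {t : ℝ}
    (hy : y ∈ Metric.ball (AffineMap.lineMap a b t : Plane) (min t (1 - t) * ‖b - a‖)) :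
    y ∈ segment ℝ a b ↔ cross (b - a) (y - AffineMap.lineMap a b t) = 0 := by
  have hne : b - a ≠ 0 := sub_ne_zero.mpr hab.symm
  rw [segment_eq_image_lineMap]
  constructor
  · rintro ⟨s, hs, rfl⟩
    have : (AffineMap.lineMap a b s : Plane) - AffineMap.lineMap a b t = (s - t) • (b - a) := by
      simp only [AffineMap.lineMap_apply_module']
      module
    rw [this, cross_smul_right, cross_self, mul_zero]
  · intro h
    obtain ⟨s, hs⟩ := exists_eq_smul_of_cross_eq_zero hne h
    rw [Metric.mem_ball, dist_eq_norm, hs, norm_smul, Real.norm_eq_abs] at hy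
    have h1 := abs_lt.mp (lt_of_mul_lt_mul_right hy (norm_nonneg _))
    refine ⟨t + s, ⟨?_, ?_⟩, ?_⟩
    · linarith [min_le_left t (1 - t)]
    · linarith [min_le_right t (1 - t)]
    · rw [sub_eq_iff_eq_add] at hs
      rw [hs]
      simp only [AffineMap.lineMap_apply_module']
      module

lemma exists_ball_disjoint {m : ℕ} (x : Polygon Plane m) (p : Plane) :
    ∃ r > 0, ∀ y ∈ Metric.ball p r, ∀ j, y ∈ segment ℝ (x j) (x (finRotate m j)) →
      p ∈ segment ℝ (x j) (x (finRotate m j)) := by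
  have h : ∀ᶠ y in nhds p, ∀ j, y ∈ segment ℝ (x j) (x (finRotate m j)) →
      p ∈ segment ℝ (x j) (x (finRotate m j)) := by
    rw [Filter.eventually_all]
    intro j
    by_cases hp : p ∈ segment ℝ (x j) (x (finRotate m j))
    · exact Filter.Eventually.of_forall fun _ _ => hp
    · filter_upwards [(isCompact_segment _ _).isClosed.isOpen_compl.mem_nhds hp] with y hy hy'
      exact absurd hy' hy
  obtain ⟨r, hr, hr'⟩ := Metric.eventually_nhds_iff_ball.mp h
  exact ⟨r, hr, hr'⟩

lemma mem_boundary_iff' {m : ℕ} {x : Polygon Plane (m + 1)} {y : Plane} :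
    y ∈ x.boundary ℝ ↔ ∃ i, y ∈ segment ℝ (x i) (x (i + 1)) := by
  simp only [mem_boundary_iff, finRotate_apply]

/-- An interior point of a side lies on no other side. -/
lemma eq_of_mem_segment_of_interior {m : ℕ} (hm : 2 ≤ m) {x : Polygon Plane (m + 1)}
    (hx : IsSimple x) {i j : Fin (m + 1)} {t : ℝ} (ht : t ∈ Set.Ioo (0 : ℝ) 1)
    (hj : AffineMap.lineMap (x i) (x (i + 1)) t ∈ segment ℝ (x j) (x (j + 1))) : j = i := by
  have hne : x i ≠ x (i + 1) := by simpa using hx.nondegenerate i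
  rw [isSimple_iff hm] at hx
  have hi : AffineMap.lineMap (x i) (x (i + 1)) t ∈ halfOpenSegment (x i) (x (i + 1)) :=
    ⟨t, ⟨ht.1.le, ht.2⟩, rfl⟩
  by_contra hji
  rcases mem_halfOpenSegment_or_eq hj with h | h
  · exact hx j i hji _ h hi
  · have h1 : AffineMap.lineMap (x i) (x (i + 1)) t ∈
        halfOpenSegment (x (j + 1)) (x (j + 1 + 1)) := h ▸ left_mem_halfOpenSegment _ _
    have h2 : j + 1 = i := by
      by_contra h2
      exact hx _ _ h2 _ h1 hi
    rw [h2] at h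
    have := AffineMap.lineMap_injective ℝ hne (h.trans (AffineMap.lineMap_apply_zero _ _).symm)
    exact ht.1.ne' this

lemma exists_ball_line {m : ℕ} (hm : 2 ≤ m) {x : Polygon Plane (m + 1)}
    (hx : IsSimple x) {i : Fin (m + 1)} {t : ℝ} (ht : t ∈ Set.Ioo (0 : ℝ) 1) :
    ∃ r > 0, ∀ y ∈ Metric.ball (AffineMap.lineMap (x i) (x (i + 1)) t : Plane) r,
      y ∈ x.boundary ℝ ↔
        cross (x (i + 1) - x i) (y - AffineMap.lineMap (x i) (x (i + 1)) t) = 0 := by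
  have hne : x i ≠ x (i + 1) := by simpa using hx.nondegenerate i
  obtain ⟨r, hr, h⟩ := exists_ball_disjoint x (AffineMap.lineMap (x i) (x (i + 1)) t)
  simp only [finRotate_apply] at h
  have hpos : 0 < min t (1 - t) * ‖x (i + 1) - x i‖ :=
    mul_pos (lt_min ht.1 (by linarith [ht.2])) (norm_pos_iff.mpr (sub_ne_zero.mpr hne.symm))
  refine ⟨min r (min t (1 - t) * ‖x (i + 1) - x i‖), lt_min hr hpos, fun y hy => ?_⟩
  have hy1 := Metric.ball_subset_ball (min_le_left _ _) hy
  have hy2 := Metric.ball_subset_ball (min_le_right _ _) hy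
  rw [← mem_segment_iff_of_mem_ball hne hy2, mem_boundary_iff']
  constructor
  · rintro ⟨j, hj⟩
    rwa [eq_of_mem_segment_of_interior hm hx ht (h y hy1 j hj)] at hj
  · exact fun hi => ⟨i, hi⟩

/-- Only two sides contain a given vertex, so nearby the curve is a pair of rays: a corner, or a
straight line if the sides are collinear. -/
lemma exists_isTwoSidedAt_vertex {m : ℕ} (hm : 2 ≤ m) {x : Polygon Plane (m + 1)}
    (hx : IsSimple x) (i : Fin (m + 1)) :
    ∃ L R, IsTwoSidedAt (x.boundary ℝ) (x (i + 1)) L R := by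
  have hne : x i ≠ x (i + 1) := by simpa using hx.nondegenerate i
  have hne' : x (i + 1) ≠ x (i + 1 + 1) := by simpa using hx.nondegenerate (i + 1)
  have hadj := hx.adjacent i
  simp only [edgeSet_eq_segment, finRotate_apply] at hadj
  rw [isSimple_iff hm] at hx
  have honly : ∀ j, x (i + 1) ∈ segment ℝ (x j) (x (j + 1)) → j = i ∨ j = i + 1 := by
    intro j hj
    rcases mem_halfOpenSegment_or_eq hj with h | h
    · right
      by_contra hji
      exact hx j (i + 1) hji _ h (left_mem_halfOpenSegment _ _)
    · left
      by_contra hji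
      refine hx (i + 1) (j + 1) (by simpa using Ne.symm hji) _ (left_mem_halfOpenSegment _ _) ?_
      rw [h]
      exact left_mem_halfOpenSegment _ _
  obtain ⟨r, hr, h⟩ := exists_ball_disjoint x (x (i + 1))
  simp only [finRotate_apply] at h
  set p := x (i + 1) with hp
  set r' := min r (min ‖x i - p‖ ‖x (i + 1 + 1) - p‖)
  have hr' : 0 < r' := lt_min hr (lt_min (norm_pos_iff.mpr (sub_ne_zero.mpr hne))
    (norm_pos_iff.mpr (sub_ne_zero.mpr hne'.symm)))
  have hloc : ∀ y ∈ Metric.ball p r', y ∈ x.boundary ℝ ↔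
      (∃ s : ℝ, 0 ≤ s ∧ y = p + s • (x i - p)) ∨
        ∃ s : ℝ, 0 ≤ s ∧ y = p + s • (x (i + 1 + 1) - p) := by
    intro y hy
    have hy1 := Metric.ball_subset_ball (min_le_left _ _) hy
    have hy2 := Metric.ball_subset_ball ((min_le_right _ _).trans (min_le_left _ _)) hy
    have hy3 := Metric.ball_subset_ball ((min_le_right _ _).trans (min_le_right _ _)) hy
    rw [← mem_segment_iff_of_mem_ball_left hy2, ← mem_segment_iff_of_mem_ball_left hy3,
      mem_boundary_iff', segment_symm ℝ p (x i)]
    constructor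
    · rintro ⟨j, hj⟩
      rcases honly j (h y hy1 j hj) with rfl | rfl
      · exact Or.inl hj
      · exact Or.inr hj
    · rintro (h | h)
      · exact ⟨i, h⟩
      · exact ⟨i + 1, h⟩
  by_cases hcross : cross (x i - p) (x (i + 1 + 1) - p) = 0
  · have hu : x i - p ≠ 0 := sub_ne_zero.mpr hne
    obtain ⟨c, hc⟩ := exists_eq_smul_of_cross_eq_zero hu hcross
    -- For `c = 0` a side would degenerate, and for `c > 0` both sides would leave `p` in the same
    -- direction and share the further point `p + min 1 c • (x i - p)`.
    have hc0 : c < 0 := by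
      by_contra! hc0
      rcases hc0.eq_or_lt with rfl | hc0
      · rw [zero_smul] at hc
        exact hne' (sub_eq_zero.mp hc).symm
      have hq : p + min 1 c • (x i - p) ∈ segment ℝ (x i) p ∩ segment ℝ p (x (i + 1 + 1)) := by
        constructor
        · rw [segment_symm, segment_eq_image_lineMap]
          refine ⟨min 1 c, ⟨(lt_min one_pos hc0).le, min_le_left _ _⟩, ?_⟩
          rw [AffineMap.lineMap_apply_module', add_comm]
        · rw [segment_eq_image_lineMap]
          refine ⟨min 1 c / c, ⟨(div_pos (lt_min one_pos hc0) hc0).le,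
            (div_le_one hc0).mpr (min_le_right _ _)⟩, ?_⟩
          rw [AffineMap.lineMap_apply_module', hc, smul_smul, div_mul_cancel₀ _ hc0.ne', add_comm]
      rw [hadj, Set.mem_singleton_iff, add_eq_left, smul_eq_zero] at hq
      rcases hq with hq | hq
      · exact (lt_min one_pos hc0).ne' hq
      · exact hu hq
    refine ⟨_, _, isTwoSidedAt_of_line hr' hu fun y hy => ?_⟩
    rw [hloc y hy, hc]
    constructor
    · rintro (⟨s, hs, rfl⟩ | ⟨s, hs, rfl⟩)
      · rw [add_sub_cancel_left, cross_smul_right, cross_self, mul_zero]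
      · rw [add_sub_cancel_left, cross_smul_right, cross_smul_right, cross_self, mul_zero, mul_zero]
    · intro h0
      obtain ⟨s, hs⟩ := exists_eq_smul_of_cross_eq_zero hu h0
      rw [sub_eq_iff_eq_add] at hs
      rcases le_total 0 s with h1 | h1
      · exact Or.inl ⟨s, h1, by rw [hs, add_comm]⟩
      · refine Or.inr ⟨s / c, div_nonneg_of_nonpos h1 hc0.le, ?_⟩
        rw [smul_smul, div_mul_cancel₀ _ hc0.ne, hs, add_comm]
  · exact isTwoSidedAt_of_corner hr' hcross hloc

lemma exists_isTwoSidedAt {m : ℕ} (hm : 2 ≤ m) {x : Polygon Plane (m + 1)}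
    (hx : IsSimple x) {p : Plane} (hp : p ∈ x.boundary ℝ) :
    ∃ L R, IsTwoSidedAt (x.boundary ℝ) p L R := by
  obtain ⟨i, hi⟩ := mem_boundary_iff'.mp hp
  have hne : x i ≠ x (i + 1) := by simpa using hx.nondegenerate i
  rw [segment_eq_image_lineMap] at hi
  obtain ⟨t, ht, rfl⟩ := hi
  rcases ht.1.eq_or_lt with rfl | h0
  · rw [AffineMap.lineMap_apply_zero]
    simpa using exists_isTwoSidedAt_vertex hm hx (i - 1)
  rcases ht.2.eq_or_lt with rfl | h1
  · rw [AffineMap.lineMap_apply_one]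
    exact exists_isTwoSidedAt_vertex hm hx i
  · obtain ⟨r, hr, h⟩ := exists_ball_line hm hx (i := i) ⟨h0, h1⟩
    exact ⟨_, _, isTwoSidedAt_of_line hr (sub_ne_zero.mpr hne.symm) h⟩

/-! ### The Jordan curve theorem for simple polygons -/

lemma isPreconnected_boundary {m : ℕ} (x : Polygon Plane (m + 1)) :
    IsPreconnected (x.boundary ℝ) := by
  have hsurj : Function.Surjective (Fin.ofNat (m + 1)) := fun i => ⟨i.val, by simp⟩
  have hsucc : ∀ k, Fin.ofNat (m + 1) (k + 1) = Fin.ofNat (m + 1) k + 1 := by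
    intro k
    ext
    simp [Fin.val_add]
  unfold Polygon.boundary
  rw [← hsurj.iUnion_comp]
  refine IsPreconnected.iUnion_of_chain (fun k => ?_) fun k => ?_
  · rw [edgeSet_eq_segment]
    exact (convex_segment _ _).isPreconnected
  · refine ⟨x (Fin.ofNat (m + 1) (k + 1)), ?_, ?_⟩
    · rw [edgeSet_eq_segment, finRotate_apply, hsucc]
      exact right_mem_segment ℝ _ _
    · rw [edgeSet_eq_segment, Order.succ_eq_add_one]
      exact left_mem_segment ℝ _ _

/-- A component accumulating at `p` meets `L ∪ R`, and being maximal connected it swallows whichever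
of the two it meets. -/
lemma subset_or_subset_of_isTwoSidedAt {Γ : Set Plane} {p y : Plane} {L R : Set Plane}
    (h : IsTwoSidedAt Γ p L R) (hp : p ∈ closure (connectedComponentIn Γᶜ y)) :
    L ⊆ connectedComponentIn Γᶜ y ∨ R ⊆ connectedComponentIn Γᶜ y := by
  obtain ⟨hL, hR, hLΓ, hRΓ, B, hB, hBLR, -, -⟩ := h
  obtain ⟨q, hqB, hqC⟩ := mem_closure_iff_nhds.mp hp B hB
  have hqΓ : q ∈ Γᶜ := connectedComponentIn_subset _ _ hqC
  rw [connectedComponentIn_eq hqC]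
  rcases hBLR ⟨hqB, hqΓ⟩ with hq | hq
  · exact Or.inl (hL.subset_connectedComponentIn hq hLΓ)
  · exact Or.inr (hR.subset_connectedComponentIn hq hRΓ)

/-- Every component of the complement accumulates at all points of the curve. -/
lemma subset_closure_connectedComponentIn {Γ : Set Plane} (hΓ : IsClosed Γ)
    (hconn : IsPreconnected Γ) (hne : Γ.Nonempty)
    (hloc : ∀ p ∈ Γ, ∃ L R, IsTwoSidedAt Γ p L R) {y : Plane} (hy : y ∉ Γ) :
    Γ ⊆ closure (connectedComponentIn Γᶜ y) := by
  set C := connectedComponentIn Γᶜ y with hC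
  have hyC : y ∈ C := mem_connectedComponentIn hy
  -- A component whose closure missed the curve would be clopen, hence the whole plane.
  have hmeet : (Γ ∩ closure C).Nonempty := by
    by_contra hempty
    rw [Set.not_nonempty_iff_eq_empty] at hempty
    have hsub : closure C ⊆ Γᶜ := fun z hz hzΓ => by
      have : z ∈ Γ ∩ closure C := ⟨hzΓ, hz⟩
      rw [hempty] at this
      exact this
    have hcl : closure C ⊆ C :=
      isPreconnected_connectedComponentIn.closure.subset_connectedComponentIn
        (subset_closure hyC) hsub
    have hclopen : IsClopen C :=
      ⟨closure_subset_iff_isClosed.mp hcl, hΓ.isOpen_compl.connectedComponentIn⟩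
    have huniv := hclopen.eq_univ ⟨y, hyC⟩
    obtain ⟨z, hz⟩ := hne
    exact connectedComponentIn_subset Γᶜ y (huniv.symm.subset (Set.mem_univ z) : z ∈ C) hz
  -- Two-sidedness makes the part of the curve in `closure C` relatively open; it is also closed and
  -- nonempty, so connectedness of the curve makes it everything.
  have hcover : ∀ p ∈ Γ, p ∈ closure C → p ∈ interior (closure C ∪ Γᶜ) := by
    intro p hp hpC
    obtain ⟨L, R, h⟩ := hloc p hp
    have hor := subset_or_subset_of_isTwoSidedAt h hpC
    obtain ⟨-, -, -, -, B, hB, -, hBL, hBR⟩ := h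
    rw [mem_interior_iff_mem_nhds]
    filter_upwards [hB] with q hq
    by_cases hqΓ : q ∈ Γ
    · left
      rcases hor with h | h
      · exact closure_mono h (hBL ⟨hqΓ, hq⟩)
      · exact closure_mono h (hBR ⟨hqΓ, hq⟩)
    · exact Or.inr hqΓ
  by_contra hnot
  obtain ⟨z, hz, hzC⟩ := Set.not_subset.mp hnot
  obtain ⟨p, hp, hpC⟩ := hmeet
  obtain ⟨q, hqΓ, hq1, hq2⟩ := hconn (interior (closure C ∪ Γᶜ)) (closure C)ᶜ isOpen_interior
    isClosed_closure.isOpen_compl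
    (fun w hw => by
      by_cases hwC : w ∈ closure C
      · exact Or.inl (hcover w hw hwC)
      · exact Or.inr hwC)
    ⟨p, hp, hcover p hp hpC⟩ ⟨z, hz, hzC⟩
  rcases interior_subset hq1 with h | h
  · exact hq2 h
  · exact h hqΓ

/-- A continuous function with integer values is constant on a connected set. -/
lemma wind_eq_of_isPreconnected {m : ℕ} {x : Polygon Plane m} {S : Set Plane}
    (hS : IsPreconnected S) (hsub : S ⊆ (x.boundary ℝ)ᶜ) {y z : Plane} (hy : y ∈ S) (hz : z ∈ S) :
    wind x y = wind x z := by
  have hcont : ContinuousOn (wind x) S := fun q hq =>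
    ((continuousAt_wind (x := x.vertices) (hsub hq)).comp
      (f := fun q : Plane => (x.vertices, q)) (by fun_prop)).continuousWithinAt
  refine hS.constant_of_mapsTo (T := Set.range ((↑) : ℤ → ℝ)) ?_ hcont ?_ hy hz
  · exact Int.isClosedEmbedding_coe_real.isEmbedding.isDiscrete_range
  · intro q hq
    exact exists_int_eq_wind (hsub hq)

lemma cross_toC_div {a b p n : Plane} {τ t : ℝ} (hp : p = AffineMap.lineMap a b τ) :
    cross (a - (p + t • n)) (b - (p + t • n)) = t * cross (b - a) n := by
  subst hp
  rw [AffineMap.lineMap_apply_module']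
  simp [cross]
  ring

/-- For `τ < 1` the limit is a negative real, on the branch cut of the argument. The side from which
the cut is approached then decides between the limits `π` and `-π`. -/
lemma tendsto_toC_div {a b n : Plane} (hab : a ≠ b) {τ : ℝ} (hτ : 0 < τ) :
    Filter.Tendsto (fun t : ℝ => toC (b - ((AffineMap.lineMap a b τ : Plane) + t • n)) /
      toC (a - ((AffineMap.lineMap a b τ : Plane) + t • n))) (nhds 0)
      (nhds ((-((1 - τ) / τ) : ℝ) : ℂ)) := by
  have hne : toC (b - a) ≠ 0 := toC_ne_zero (sub_ne_zero.mpr hab.symm)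
  have h1 : toC (a - (AffineMap.lineMap a b τ : Plane)) = ((-τ : ℝ) : ℂ) * toC (b - a) := by
    rw [← Complex.real_smul, ← map_smul]
    congr 1
    rw [AffineMap.lineMap_apply_module']
    module
  have h2 : toC (b - (AffineMap.lineMap a b τ : Plane)) = ((1 - τ : ℝ) : ℂ) * toC (b - a) := by
    rw [← Complex.real_smul, ← map_smul]
    congr 1
    rw [AffineMap.lineMap_apply_module']
    module
  have hcont : ∀ c : Plane, Continuous fun t : ℝ =>
      toC (c - ((AffineMap.lineMap a b τ : Plane) + t • n)) := fun c =>
    toC.continuous.comp (by fun_prop)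
  have h := ((hcont b).tendsto 0).div ((hcont a).tendsto 0) (by
    rw [zero_smul, add_zero, h1]
    exact mul_ne_zero (by exact_mod_cast (neg_ne_zero.mpr hτ.ne')) hne)
  rw [zero_smul, add_zero, h1, h2, mul_div_mul_right _ _ hne] at h
  convert! h using 2
  push_cast
  rw [div_neg]

lemma im_toC_div (u v : Plane) : (toC v / toC u).im = cross u v / ‖u‖ ^ 2 :=
  (cross_div_norm_sq u v).symm

lemma tendsto_ang_left {a b n : Plane} (hab : a ≠ b) {τ : ℝ} (hτ : τ ∈ Set.Ioo (0 : ℝ) 1)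
    (hn : 0 < cross (b - a) n) :
    Filter.Tendsto (fun t : ℝ => ang a b ((AffineMap.lineMap a b τ : Plane) + t • n))
      (nhdsWithin 0 (Set.Ioi 0)) (nhds Real.pi) := by
  have hneg : -((1 - τ) / τ) < 0 := by
    have : 0 < (1 - τ) / τ := div_pos (by linarith [hτ.2]) hτ.1
    linarith
  have h := Complex.continuousWithinAt_arg_of_re_neg_of_im_zero
    (z := ((-((1 - τ) / τ) : ℝ) : ℂ)) (by simpa using hneg) (Complex.ofReal_im _)
  have harg := Complex.arg_ofReal_of_neg hneg
  unfold ContinuousWithinAt at h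
  rw [harg] at h
  refine h.comp (tendsto_nhdsWithin_iff.mpr
    ⟨(tendsto_toC_div hab hτ.1).mono_left nhdsWithin_le_nhds, ?_⟩)
  filter_upwards [self_mem_nhdsWithin] with t ht
  rw [im_toC_div, cross_toC_div rfl]
  have := mul_pos (Set.mem_Ioi.mp ht) hn
  positivity

lemma tendsto_ang_right {a b n : Plane} (hab : a ≠ b) {τ : ℝ} (hτ : τ ∈ Set.Ioo (0 : ℝ) 1)
    (hn : 0 < cross (b - a) n) :
    Filter.Tendsto (fun t : ℝ => ang a b ((AffineMap.lineMap a b τ : Plane) + t • n))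
      (nhdsWithin 0 (Set.Iio 0)) (nhds (-Real.pi)) := by
  have hneg : -((1 - τ) / τ) < 0 := by
    have : 0 < (1 - τ) / τ := div_pos (by linarith [hτ.2]) hτ.1
    linarith
  have h := Complex.tendsto_arg_nhdsWithin_im_neg_of_re_neg_of_im_zero
    (z := ((-((1 - τ) / τ) : ℝ) : ℂ)) (by simpa using hneg) (Complex.ofReal_im _)
  refine h.comp (tendsto_nhdsWithin_iff.mpr
    ⟨(tendsto_toC_div hab hτ.1).mono_left nhdsWithin_le_nhds, ?_⟩)
  have hev : ∀ᶠ t : ℝ in nhdsWithin 0 (Set.Iio 0),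
      toC (a - ((AffineMap.lineMap a b τ : Plane) + t • n)) ≠ 0 := by
    have hev' := (tendsto_toC_div (n := n) hab hτ.1).eventually
      (isOpen_ne.mem_nhds (Complex.ofReal_ne_zero.mpr hneg.ne))
    filter_upwards [hev'.filter_mono nhdsWithin_le_nhds] with t ht h0
    simp [h0] at ht
  filter_upwards [self_mem_nhdsWithin, hev] with t ht ht'
  rw [im_toC_div, cross_toC_div rfl]
  have h1 := mul_neg_of_neg_of_pos (Set.mem_Iio.mp ht) hn
  have h2 : 0 < ‖a - ((AffineMap.lineMap a b τ : Plane) + t • n)‖ ^ 2 := by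
    have := norm_pos_iff.mpr ht'
    rw [LinearIsometryEquiv.norm_map] at this
    positivity
  exact div_neg_of_neg_of_pos h1 h2

/-- The winding number jumps by one across a side. -/
lemma exists_jump {m : ℕ} (hm : 2 ≤ m) {x : Polygon Plane (m + 1)} (hx : IsSimple x) :
    ∃ p ∈ x.boundary ℝ, ∃ L R, IsTwoSidedAt (x.boundary ℝ) p L R ∧ ∃ w : ℝ,
      (∀ y ∈ L, wind x y = w + 1) ∧ ∀ y ∈ R, wind x y = w := by
  have hne : x 0 ≠ x (0 + 1) := by simpa using hx.nondegenerate 0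
  have hτ : (2⁻¹ : ℝ) ∈ Set.Ioo (0 : ℝ) 1 := by norm_num
  obtain ⟨r, hr, h⟩ := exists_ball_line hm hx (i := 0) hτ
  set p : Plane := AffineMap.lineMap (x 0) (x (0 + 1)) (2⁻¹ : ℝ) with hp
  set u := x (0 + 1) - x 0 with hu
  have hu0 : u ≠ 0 := sub_ne_zero.mpr hne.symm
  have hpos : 0 < cross u (rotate u) := by
    rw [cross_rotate]
    positivity
  have htwo := isTwoSidedAt_of_line hr hu0 h
  have hline : Continuous fun t : ℝ => p + t • rotate u := by fun_prop
  have hball : ∀ᶠ t : ℝ in nhds 0, p + t • rotate u ∈ Metric.ball p r := by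
    apply hline.continuousAt.eventually_mem
    simpa using Metric.ball_mem_nhds p hr
  have hmemL : ∀ᶠ t : ℝ in nhdsWithin 0 (Set.Ioi 0), p + t • rotate u ∈
      Metric.ball p r ∩ {y | 0 < cross u (y - p)} := by
    filter_upwards [hball.filter_mono nhdsWithin_le_nhds, self_mem_nhdsWithin] with t h1 h2
    refine ⟨h1, ?_⟩
    rw [Set.mem_ofPred_eq, add_sub_cancel_left, cross_smul_right]
    exact mul_pos h2 hpos
  have hmemR : ∀ᶠ t : ℝ in nhdsWithin 0 (Set.Iio 0), p + t • rotate u ∈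
      Metric.ball p r ∩ {y | 0 < cross (-u) (y - p)} := by
    filter_upwards [hball.filter_mono nhdsWithin_le_nhds, self_mem_nhdsWithin] with t h1 h2
    refine ⟨h1, ?_⟩
    rw [Set.mem_ofPred_eq, add_sub_cancel_left, cross_smul_right, cross_neg_left]
    have := mul_neg_of_neg_of_pos (Set.mem_Iio.mp h2) hpos
    linarith
  -- The other sides miss `p`, so their angles vary continuously there and the whole jump comes from
  -- side `0`.
  set W : ℝ := ∑ j ∈ Finset.univ.erase 0, ang (x j) (x (j + 1)) p
  have hrest : Filter.Tendsto (fun t : ℝ => ∑ j ∈ Finset.univ.erase 0,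
      ang (x j) (x (j + 1)) (p + t • rotate u)) (nhds 0) (nhds W) := by
    refine tendsto_finsetSum _ fun j hj => ?_
    have hpj : p ∉ segment ℝ (x j) (x (j + 1)) := fun hmem =>
      (Finset.ne_of_mem_erase hj) (eq_of_mem_segment_of_interior hm hx hτ hmem)
    have h1 := continuousAt_ang hpj
    refine Filter.Tendsto.comp (g := fun q : Plane × Plane × Plane => ang q.1 q.2.1 q.2.2)
      (f := fun t : ℝ => (x j, x (j + 1), p + t • rotate u)) h1 ?_
    have h2 : Continuous fun t : ℝ => (x j, x (j + 1), p + t • rotate u) := by fun_prop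
    simpa using h2.tendsto 0
  have hwind : ∀ y, wind x y = (2 * Real.pi)⁻¹ * (ang (x 0) (x (0 + 1)) y +
      ∑ j ∈ Finset.univ.erase 0, ang (x j) (x (j + 1)) y) := by
    intro y
    rw [wind, edgeSum]
    simp only [finRotate_apply]
    rw [← Finset.add_sum_erase _ _ (Finset.mem_univ (0 : Fin (m + 1)))]
  have hlimL : Filter.Tendsto (fun t : ℝ => wind x (p + t • rotate u)) (nhdsWithin 0 (Set.Ioi 0))
      (nhds ((2 * Real.pi)⁻¹ * (Real.pi + W))) := by
    simp_rw [hwind]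
    exact ((tendsto_ang_left hne hτ hpos).add (hrest.mono_left nhdsWithin_le_nhds)).const_mul _
  have hlimR : Filter.Tendsto (fun t : ℝ => wind x (p + t • rotate u)) (nhdsWithin 0 (Set.Iio 0))
      (nhds ((2 * Real.pi)⁻¹ * (-Real.pi + W))) := by
    simp_rw [hwind]
    exact ((tendsto_ang_right hne hτ hpos).add (hrest.mono_left nhdsWithin_le_nhds)).const_mul _
  refine ⟨p, (h p (Metric.mem_ball_self hr)).mpr (by simp [cross]), _, _, htwo,
    (2 * Real.pi)⁻¹ * (-Real.pi + W), fun y hy => ?_, fun y hy => ?_⟩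
  · have h1 : ∀ᶠ t : ℝ in nhdsWithin 0 (Set.Ioi 0), wind x (p + t • rotate u) = wind x y := by
      filter_upwards [hmemL] with t ht
      exact wind_eq_of_isPreconnected htwo.1 htwo.2.2.1 ht hy
    have h2 := tendsto_nhds_unique (tendsto_const_nhds.congr' (h1.mono fun _ h => h.symm)) hlimL
    rw [h2]
    field_simp
    ring
  · have h1 : ∀ᶠ t : ℝ in nhdsWithin 0 (Set.Iio 0), wind x (p + t • rotate u) = wind x y := by
      filter_upwards [hmemR] with t ht
      exact wind_eq_of_isPreconnected htwo.2.1 htwo.2.2.2.1 ht hy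
    exact tendsto_nhds_unique (tendsto_const_nhds.congr' (h1.mono fun _ h => h.symm)) hlimR

lemma boundary_subset_closedBall {m : ℕ} (x : Polygon Plane m) (i : Fin m) :
    x.boundary ℝ ⊆ Metric.closedBall (x i) (length x) := by
  intro y hy
  obtain ⟨j, hj⟩ := mem_boundary_iff.mp hy
  exact (convex_closedBall (x i) (length x)).segment_subset
    (Metric.mem_closedBall.mpr (dist_vertices_le x _ i))
    (Metric.mem_closedBall.mpr (dist_vertices_le x _ i)) hj

lemma exists_dist_gt (p : Plane) (r : ℝ) : ∃ q : Plane, r < dist q p := by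
  refine ⟨p + EuclideanSpace.single 0 (|r| + 1), ?_⟩
  rw [dist_eq_norm, add_sub_cancel_left, PiLp.norm_single, Real.norm_eq_abs,
    abs_of_pos (by positivity)]
  linarith [le_abs_self r]

lemma isOpen_region {m : ℕ} (x : Polygon Plane m) : IsOpen (region x) := by
  have hopen : IsOpen (x.boundary ℝ)ᶜ := (isCompact_boundary x).isClosed.isOpen_compl
  rw [isOpen_iff_mem_nhds]
  rintro y ⟨hy, hb⟩
  filter_upwards [hopen.connectedComponentIn.mem_nhds (mem_connectedComponentIn hy)] with z hz
  refine ⟨connectedComponentIn_subset _ _ hz, ?_⟩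
  rwa [← connectedComponentIn_eq hz]

/-- The winding number of a simple polygon is constantly `1` or constantly `-1` in the enclosed
region, and it vanishes outside. -/
theorem exists_wind_eq_indicator {m : ℕ} (hm : 3 ≤ m) {x : Polygon Plane m} (hx : IsSimple x) :
    ∃ s : ℝ, |s| = 1 ∧ ∀ y ∉ x.boundary ℝ, wind x y = (region x).indicator (fun _ => s) y := by
  obtain ⟨m, rfl⟩ : ∃ k, m = k + 1 := ⟨m - 1, by omega⟩
  have hm' : 2 ≤ m := by omega
  set Γ := x.boundary ℝ with hΓdef
  have hΓ : IsClosed Γ := (isCompact_boundary x).isClosed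
  obtain ⟨p, hp, L, R, htwo, w, hL, hR⟩ := exists_jump hm' hx
  have hclosure : ∀ y ∉ Γ, Γ ⊆ closure (connectedComponentIn Γᶜ y) := fun y hy =>
    subset_closure_connectedComponentIn hΓ (isPreconnected_boundary x) ⟨p, hp⟩
      (fun q hq => exists_isTwoSidedAt hm' hx hq) hy
  have hwC : ∀ y ∉ Γ, ∀ z ∈ connectedComponentIn Γᶜ y, wind x y = wind x z := fun y hy z hz =>
    wind_eq_of_isPreconnected isPreconnected_connectedComponentIn
      (connectedComponentIn_subset _ _) (mem_connectedComponentIn hy) hz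
  have hLne : L.Nonempty := by
    obtain ⟨-, -, -, -, B, hB, -, hBL, -⟩ := htwo
    exact closure_nonempty_iff.mp ⟨p, hBL ⟨hp, mem_of_mem_nhds hB⟩⟩
  have hRne : R.Nonempty := by
    obtain ⟨-, -, -, -, B, hB, -, -, hBR⟩ := htwo
    exact closure_nonempty_iff.mp ⟨p, hBR ⟨hp, mem_of_mem_nhds hB⟩⟩
  -- Every component contains `L` or `R`. The winding number differs on the two, so it identifies
  -- the component.
  have hor : ∀ y ∉ Γ, (L ⊆ connectedComponentIn Γᶜ y ∧ wind x y = w + 1) ∨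
      (R ⊆ connectedComponentIn Γᶜ y ∧ wind x y = w) := by
    intro y hy
    rcases subset_or_subset_of_isTwoSidedAt htwo (hclosure y hy hp) with h | h
    · obtain ⟨z, hz⟩ := hLne
      exact Or.inl ⟨h, (hwC y hy z (h hz)).trans (hL z hz)⟩
    · obtain ⟨z, hz⟩ := hRne
      exact Or.inr ⟨h, (hwC y hy z (h hz)).trans (hR z hz)⟩
  have hsame : ∀ y ∉ Γ, ∀ z ∉ Γ, wind x y = wind x z → z ∈ connectedComponentIn Γᶜ y := by
    intro y hy z hz hyz
    have key : ∀ S : Set Plane, S.Nonempty → S ⊆ connectedComponentIn Γᶜ y →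
        S ⊆ connectedComponentIn Γᶜ z → z ∈ connectedComponentIn Γᶜ y := by
      rintro S ⟨q, hq⟩ h1 h2
      rw [connectedComponentIn_eq (h1 hq), ← connectedComponentIn_eq (h2 hq)]
      exact mem_connectedComponentIn hz
    rcases hor y hy with ⟨h1, h1'⟩ | ⟨h1, h1'⟩ <;> rcases hor z hz with ⟨h2, h2'⟩ | ⟨h2, h2'⟩
    · exact key L hLne h1 h2
    · linarith
    · linarith
    · exact key R hRne h1 h2
  have hfar : ∀ q, length x < dist q (x 0) → q ∉ Γ ∧ wind x q = 0 := fun q hq =>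
    ⟨fun hqΓ => absurd (boundary_subset_closedBall x 0 hqΓ) (by simpa using hq),
      wind_eq_zero_of_lt x 0 hq⟩
  have hregion : ∀ y ∉ Γ, (y ∈ region x ↔ wind x y ≠ 0) := by
    intro y hy
    constructor
    · rintro ⟨-, hb⟩ h0
      obtain ⟨ρ, hρ⟩ := hb.subset_closedBall (x 0)
      obtain ⟨q, hq⟩ := exists_dist_gt (x 0) (max ρ (length x))
      obtain ⟨hqΓ, hq0⟩ := hfar q ((le_max_right _ _).trans_lt hq)
      have := Metric.mem_closedBall.mp (hρ (hsame y hy q hqΓ (h0.trans hq0.symm)))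
      linarith [le_max_left ρ (length x)]
    · intro h0
      refine ⟨hy, (Metric.isBounded_closedBall (x := x 0) (r := length x)).subset fun z hz => ?_⟩
      by_contra hzb
      rw [Metric.mem_closedBall, not_le] at hzb
      exact h0 ((hwC y hy z hz).trans (hfar z hzb).2)
  obtain ⟨q, hq⟩ := exists_dist_gt (x 0) (length x)
  obtain ⟨hqΓ, hq0⟩ := hfar q hq
  -- One of `w` and `w + 1` is the value `0` taken far away, so their sum is the other value, which
  -- is `1` or `-1`.
  refine ⟨w + (w + 1), ?_, fun y hy => ?_⟩
  · rcases hor q hqΓ with ⟨-, h⟩ | ⟨-, h⟩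
    · have : w + (w + 1) = -1 := by linarith
      rw [this]; simp
    · have : w + (w + 1) = 1 := by linarith
      rw [this]; simp
  · by_cases hyr : y ∈ region x
    · rw [Set.indicator_of_mem hyr]
      have h0 := (hregion y hy).mp hyr
      rcases hor q hqΓ with ⟨-, h⟩ | ⟨-, h⟩ <;> rcases hor y hy with ⟨-, h'⟩ | ⟨-, h'⟩
      · exact absurd (by linarith) h0
      · linarith
      · linarith
      · exact absurd (by linarith) h0
    · rw [Set.indicator_of_notMem hyr]
      by_contra h0
      exact hyr ((hregion y hy).mpr h0)

/-- The relaxed area of a simple polygon is, up to sign, the weighted area of its region. -/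
theorem abs_relaxedArea_eq (η : Plane → ℝ) {m : ℕ} (hm : 3 ≤ m) {x : Polygon Plane m}
    (hx : IsSimple x) : |relaxedArea η x| = |∫ p in region x, η p| := by
  obtain ⟨s, hs, h⟩ := exists_wind_eq_indicator hm hx
  have h1 : relaxedArea η x = s * ∫ p in region x, η p := by
    rw [relaxedArea_eq, ← integral_indicator (isOpen_region x).measurableSet, ← integral_const_mul]
    apply integral_congr_ae
    filter_upwards [ae_notMem_boundary x] with y hy
    rw [h y hy]
    by_cases hyr : y ∈ region x <;> simp [hyr, mul_comm]
  rw [h1, abs_mul, hs, one_mul]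

/-! ### The winding number counts crossings of a vertical ray -/

/-- The signed number of crossings of the upward vertical ray from `y` with the segment from
`a` to `b`. -/
def crossing (a b y : Plane) : ℝ :=
  if b 0 < y 0 ∧ y 0 < a 0 ∧ 0 < cross (a - y) (b - y) then 1
  else if a 0 < y 0 ∧ y 0 < b 0 ∧ cross (a - y) (b - y) < 0 then -1 else 0

lemma arg_pos_of_im_pos {z : ℂ} (h : 0 < z.im) : 0 < z.arg ∧ z.arg < Real.pi := by
  refine ⟨(Complex.arg_nonneg_iff.mpr h.le).lt_of_ne fun h0 => ?_,
    (Complex.arg_le_pi z).lt_of_ne fun h0 => ?_⟩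
  · exact h.ne' (Complex.arg_eq_zero_iff.mp h0.symm).2
  · exact h.ne' (Complex.arg_eq_pi_iff.mp h0).2

lemma arg_neg_of_im_neg {z : ℂ} (h : z.im < 0) : -Real.pi < z.arg ∧ z.arg < 0 :=
  ⟨Complex.neg_pi_lt_arg z, Complex.arg_neg_iff.mpr h⟩

/-- Multiplication by `I` moves the branch cut of the argument to the upward vertical ray from `y`.
The angle is then the difference of the new arguments, corrected by `2π` whenever the segment
crosses that ray. -/
lemma ang_eq_crossing {a b y : Plane} (h : y ∉ segment ℝ a b) (ha : y 0 ≠ a 0) (hb : y 0 ≠ b 0) :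
    ang a b y = (Complex.I * toC (b - y)).arg - (Complex.I * toC (a - y)).arg +
      2 * Real.pi * crossing a b y := by
  set u := Complex.I * toC (a - y) with hu
  set v := Complex.I * toC (b - y) with hv
  have hquot : toC (b - y) / toC (a - y) = v / u := by
    rw [hu, hv, mul_div_mul_left _ _ Complex.I_ne_zero]
  have huim : u.im = a 0 - y 0 := by simp [hu]
  have hvim : v.im = b 0 - y 0 := by simp [hv]
  have hu0 : u ≠ 0 := fun h0 => by
    rw [h0] at huim
    exact ha (by simp at huim; linarith)
  have hv0 : v ≠ 0 := fun h0 => by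
    rw [h0] at hvim
    exact hb (by simp at hvim; linarith)
  have hsu := lt_or_gt_of_ne ha
  have hsv := lt_or_gt_of_ne hb
  have hang : ang a b y = (v / u).arg := by rw [ang, hquot]
  have hslit : v / u ∈ Complex.slitPlane := hquot ▸ toC_div_mem_slitPlane h
  have hmod : ∃ k : ℤ, (v / u).arg = v.arg - u.arg + k * (2 * Real.pi) := by
    have h1 := Complex.arg_div_coe_angle hv0 hu0
    rw [← Real.Angle.coe_sub, ← sub_eq_zero, ← Real.Angle.coe_sub,
      Real.Angle.coe_eq_zero_iff] at h1
    obtain ⟨k, hk⟩ := h1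
    rw [zsmul_eq_mul] at hk
    exact ⟨k, by linarith⟩
  have hpi := Real.pi_pos
  have hcross : (v / u).im = cross (a - y) (b - y) / ‖a - y‖ ^ 2 := by
    rw [← hquot, im_toC_div]
  have hnorm : 0 < ‖a - y‖ ^ 2 := by
    have : a - y ≠ 0 := fun h0 => hu0 (by rw [hu, h0]; simp)
    positivity
  have hne : u.im * v.im < 0 → cross (a - y) (b - y) ≠ 0 := by
    intro hsign h0
    rw [h0, zero_div] at hcross
    have hre : 0 < (v / u).re := by
      rcases Complex.mem_slitPlane_iff.mp hslit with h1 | h1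
      · exact h1
      · exact absurd hcross h1
    have h2 : v = ((v / u).re : ℂ) * u := by
      have : v / u = ((v / u).re : ℂ) := by apply Complex.ext <;> simp [hcross]
      rw [← this, div_mul_cancel₀ _ hu0]
    have h3 : v.im = (v / u).re * u.im := by
      conv_lhs => rw [h2]
      rw [Complex.im_ofReal_mul]
    rw [h3] at hsign
    nlinarith [mul_nonneg hre.le (mul_self_nonneg u.im)]
  -- The correction is an integer multiple of `2π`; bounds of width less than `2π` on either side
  -- determine the integer.
  have hk : ∀ k : ℤ, (v / u).arg = v.arg - u.arg + k * (2 * Real.pi) →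
      ∀ l : ℤ, (l - 1 : ℝ) * (2 * Real.pi) < (v / u).arg - (v.arg - u.arg) →
      (v / u).arg - (v.arg - u.arg) < (l + 1 : ℝ) * (2 * Real.pi) →
      (v / u).arg = v.arg - u.arg + l * (2 * Real.pi) := by
    intro k hk l h1 h2
    have e : (v / u).arg - (v.arg - u.arg) = k * (2 * Real.pi) := by linarith
    rw [e] at h1 h2
    have h3 := lt_of_mul_lt_mul_right h1 (by positivity)
    have h4 := lt_of_mul_lt_mul_right h2 (by positivity)
    have h5 : l - 1 < k := by exact_mod_cast h3
    have h6 : k < l + 1 := by exact_mod_cast h4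
    have : k = l := by omega
    rw [hk, this]
  obtain ⟨k, hk0⟩ := hmod
  have hk := hk k hk0
  rw [hang]
  unfold crossing
  rcases hsu with hsu | hsu <;> rcases hsv with hsv | hsv
  · obtain ⟨h1, h2⟩ := arg_pos_of_im_pos (z := u) (by linarith)
    obtain ⟨h3, h4⟩ := arg_pos_of_im_pos (z := v) (by linarith)
    rw [if_neg (fun hc => by linarith [hc.1]), if_neg (fun hc => by linarith [hc.1]),
      arg_div_of_abs_sub_lt hu0 hv0 (by rw [abs_lt]; constructor <;> linarith)]
    ring
  · obtain ⟨h1, h2⟩ := arg_pos_of_im_pos (z := u) (by linarith)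
    obtain ⟨h3, h4⟩ := arg_neg_of_im_neg (z := v) (by linarith)
    rcases lt_or_gt_of_ne (hne (mul_neg_of_pos_of_neg (by linarith) (by linarith))) with h5 | h5
    · rw [if_neg (fun hc => by linarith [hc.2.2]), if_neg (fun hc => by linarith [hc.1])]
      obtain ⟨h6, h7⟩ := arg_neg_of_im_neg (z := v / u)
        (hcross ▸ div_neg_of_neg_of_pos h5 hnorm)
      rw [hk 0 (by push_cast; linarith) (by push_cast; linarith)]
      simp
    · rw [if_pos ⟨hsv, hsu, h5⟩]
      obtain ⟨h6, h7⟩ := arg_pos_of_im_pos (z := v / u) (hcross ▸ div_pos h5 hnorm)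
      rw [hk 1 (by push_cast; linarith) (by push_cast; linarith)]
      simp
  · obtain ⟨h1, h2⟩ := arg_neg_of_im_neg (z := u) (by linarith)
    obtain ⟨h3, h4⟩ := arg_pos_of_im_pos (z := v) (by linarith)
    rw [if_neg (fun hc => by linarith [hc.1])]
    rcases lt_or_gt_of_ne (hne (mul_neg_of_neg_of_pos (by linarith) (by linarith))) with h5 | h5
    · rw [if_pos ⟨hsu, hsv, h5⟩]
      obtain ⟨h6, h7⟩ := arg_neg_of_im_neg (z := v / u)
        (hcross ▸ div_neg_of_neg_of_pos h5 hnorm)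
      rw [hk (-1) (by push_cast; linarith) (by push_cast; linarith)]
      push_cast
      ring
    · rw [if_neg (fun hc => by linarith [hc.2.2])]
      obtain ⟨h6, h7⟩ := arg_pos_of_im_pos (z := v / u) (hcross ▸ div_pos h5 hnorm)
      rw [hk 0 (by push_cast; linarith) (by push_cast; linarith)]
      simp
  · obtain ⟨h1, h2⟩ := arg_neg_of_im_neg (z := u) (by linarith)
    obtain ⟨h3, h4⟩ := arg_neg_of_im_neg (z := v) (by linarith)
    rw [if_neg (fun hc => by linarith [hc.2.1]), if_neg (fun hc => by linarith [hc.2.1]),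
      arg_div_of_abs_sub_lt hu0 hv0 (by rw [abs_lt]; constructor <;> linarith)]
    ring

lemma ae_coord_ne (c : ℝ) : ∀ᵐ y : Plane, y 0 ≠ c := by
  have h : volume {f : Fin 2 → ℝ | f 0 = c} = 0 := Measure.pi_hyperplane (fun _ : Fin 2 => (volume : Measure ℝ)) 0 c
  rw [ae_iff]
  have h1 := (PiLp.volume_preserving_ofLp (Fin 2)).measure_preimage
    (s := {f : Fin 2 → ℝ | f 0 = c})
    (measurableSet_eq_fun (measurable_pi_apply 0) measurable_const).nullMeasurableSet
  rw [h] at h1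
  convert! h1 using 2
  ext y
  simp

/-- The argument differences cancel around the closed curve and only the crossings remain. The
exceptional points lie on the curve or vertically above or below a vertex. -/
lemma ae_wind_eq {m : ℕ} (x : Polygon Plane m) :
    ∀ᵐ y : Plane, wind x y = edgeSum (fun a b => crossing a b y) x := by
  have h : ∀ᵐ y : Plane, ∀ i, y 0 ≠ x i 0 := ae_all_iff.mpr fun i => ae_coord_ne _
  filter_upwards [h, ae_notMem_boundary x] with y hy hyb
  rw [notMem_boundary_iff] at hyb
  unfold wind edgeSum
  rw [Finset.sum_congr rfl fun i _ => ang_eq_crossing (hyb i) (hy i) (hy _),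
    Finset.sum_add_distrib, Finset.sum_sub_distrib,
    Equiv.sum_comp (finRotate m) fun i => (Complex.I * toC (x i - y)).arg, sub_self, zero_add,
    ← Finset.mul_sum, inv_mul_cancel_left₀ (by positivity)]

/-! ### The Gauss-Green formula -/

/-- The measurable identification of the plane with `ℝ × ℝ`. -/
def planeEquivProd : Plane ≃ᵐ ℝ × ℝ :=
  (MeasurableEquiv.toLp 2 (Fin 2 → ℝ)).symm.trans MeasurableEquiv.finTwoArrow

lemma measurePreserving_planeEquivProd : MeasurePreserving planeEquivProd volume volume :=
  (EuclideanSpace.volume_preserving_symm_measurableEquiv_toLp (Fin 2)).trans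
    (volume_preserving_finTwoArrow ℝ)

lemma planeEquivProd_symm_apply (s t : ℝ) : planeEquivProd.symm (s, t) = !₂[s, t] := by
  rw [MeasurableEquiv.symm_apply_eq]
  simp [planeEquivProd, MeasurableEquiv.finTwoArrow]

lemma integral_plane {F : Plane → ℝ} (hF : Integrable F) :
    ∫ y, F y = ∫ s : ℝ, ∫ t : ℝ, F !₂[s, t] := by
  have hsymm := measurePreserving_planeEquivProd.symm
  have hint : Integrable (fun p => F (planeEquivProd.symm p)) (volume.prod volume) :=
    (hsymm.integrable_comp_emb planeEquivProd.symm.measurableEmbedding).mpr hF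
  rw [← hsymm.integral_comp' F, Measure.volume_eq_prod, integral_prod _ hint]
  simp_rw [planeEquivProd_symm_apply]

lemma measurable_crossing (a b : Plane) : Measurable (crossing a b) := by
  have h0 : Measurable fun y : Plane => y 0 := by fun_prop
  have h1 : Measurable fun y : Plane => cross (a - y) (b - y) :=
    (continuous_cross (by fun_prop) (by fun_prop)).measurable
  unfold crossing
  refine Measurable.ite ?_ measurable_const (Measurable.ite ?_ measurable_const measurable_const)
  · exact (measurableSet_lt measurable_const h0).inter
      ((measurableSet_lt h0 measurable_const).inter (measurableSet_lt measurable_const h1))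
  · exact (measurableSet_lt measurable_const h0).inter
      ((measurableSet_lt h0 measurable_const).inter (measurableSet_lt h1 measurable_const))

lemma abs_crossing_le (a b y : Plane) : |crossing a b y| ≤ 1 := by
  unfold crossing
  split_ifs <;> simp

lemma integrable_mul_crossing {f : Plane → ℝ} (hf : Continuous f) (hfc : HasCompactSupport f)
    (a b : Plane) : Integrable fun y => f y * crossing a b y :=
  (hf.integrable_of_hasCompactSupport hfc).mul_bdd (c := 1)
    (measurable_crossing a b).aestronglyMeasurable
    (Filter.Eventually.of_forall (abs_crossing_le a b))

lemma crossing_eq {a b y : Plane} (hab : a 0 ≠ b 0) :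
    crossing a b y =
      if y 1 < a 1 + (y 0 - a 0) / (b 0 - a 0) * (b 1 - a 1) then
        (if b 0 < y 0 ∧ y 0 < a 0 then 1 else if a 0 < y 0 ∧ y 0 < b 0 then -1 else 0) else 0 := by
  have hc : cross (a - y) (b - y) =
      (b 0 - a 0) * (y 1 - (a 1 + (y 0 - a 0) / (b 0 - a 0) * (b 1 - a 1))) := by
    have : b 0 - a 0 ≠ 0 := sub_ne_zero.mpr hab.symm
    simp [cross]
    field_simp
    ring
  unfold crossing
  rw [hc]
  set l := a 1 + (y 0 - a 0) / (b 0 - a 0) * (b 1 - a 1)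
  rcases lt_or_gt_of_ne hab with h | h
  · have h1 : ¬ (b 0 < y 0 ∧ y 0 < a 0) := fun h1 => by linarith
    have h2 : (b 0 - a 0) * (y 1 - l) < 0 ↔ y 1 < l := by
      rw [← neg_pos, ← mul_neg, mul_pos_iff_of_pos_left (by linarith), neg_pos, sub_neg]
    have h3 : ¬ (b 0 < y 0 ∧ y 0 < a 0 ∧ 0 < (b 0 - a 0) * (y 1 - l)) :=
      fun h3 => h1 ⟨h3.1, h3.2.1⟩
    rw [if_neg h1, if_neg h3]
    simp only [h2]
    by_cases h4 : y 1 < l <;> simp [h4]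
  · have h1 : ¬ (a 0 < y 0 ∧ y 0 < b 0) := fun h1 => by linarith
    have h2 : 0 < (b 0 - a 0) * (y 1 - l) ↔ y 1 < l := by
      rw [← neg_mul_neg, mul_pos_iff_of_pos_left (by linarith), neg_pos, sub_neg]
    have h3 : ¬ (a 0 < y 0 ∧ y 0 < b 0 ∧ (b 0 - a 0) * (y 1 - l) < 0) :=
      fun h3 => h1 ⟨h3.1, h3.2.1⟩
    rw [if_neg h1, if_neg h3]
    simp only [h2]
    by_cases h4 : y 1 < l <;> simp [h4]

/-- On each vertical line `crossing a b` is a signed indicator of the part below the segment, so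
Fubini applies; the orientation of the interval from `a 0` to `b 0` absorbs the sign. -/
lemma integral_mul_crossing_eq_intervalIntegral {f : Plane → ℝ} (hf : Continuous f)
    (hfc : HasCompactSupport f) (a b : Plane) :
    ∫ y, f y * crossing a b y = -∫ s in a 0..b 0,
      ∫ t in Set.Iio (a 1 + (s - a 0) / (b 0 - a 0) * (b 1 - a 1)), f !₂[s, t] := by
  rcases eq_or_ne (a 0) (b 0) with hab | hab
  · have h0 : ∀ y, crossing a b y = 0 := by
      intro y
      unfold crossing
      rw [if_neg (fun h => by linarith [h.1, h.2.1]), if_neg (fun h => by linarith [h.1, h.2.1])]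
    simp [h0, hab]
  set l : ℝ → ℝ := fun s => a 1 + (s - a 0) / (b 0 - a 0) * (b 1 - a 1)
  set σ : ℝ → ℝ := fun s => if b 0 < s ∧ s < a 0 then 1 else if a 0 < s ∧ s < b 0 then -1 else 0
  have hin : ∀ s, ∫ t, f !₂[s, t] * crossing a b !₂[s, t] =
      σ s * ∫ t in Set.Iio (l s), f !₂[s, t] := by
    intro s
    rw [← integral_indicator measurableSet_Iio, ← integral_const_mul]
    congr 1 with t
    rw [show crossing a b !₂[s, t] = if t < l s then σ s else 0 from crossing_eq hab]
    by_cases ht : t < l s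
    · rw [if_pos ht, Set.indicator_of_mem (Set.mem_Iio.mpr ht), mul_comm]
    · rw [if_neg ht, Set.indicator_of_notMem (by simpa using ht), mul_zero, mul_zero]
  rw [integral_plane (integrable_mul_crossing hf hfc a b)]
  simp_rw [hin]
  rcases lt_or_gt_of_ne hab with h | h
  · rw [intervalIntegral.integral_of_le h.le, integral_Ioc_eq_integral_Ioo,
      ← integral_indicator measurableSet_Ioo, ← integral_neg]
    congr 1 with s
    by_cases hs : a 0 < s ∧ s < b 0
    · rw [Set.indicator_of_mem (Set.mem_Ioo.mpr hs)]
      simp only [σ]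
      rw [if_neg (fun h1 => by linarith [h1.1, hs.2]), if_pos hs]
      ring
    · rw [Set.indicator_of_notMem (by simpa using hs)]
      simp only [σ]
      rw [if_neg (fun h1 => by linarith [h1.1, h1.2]), if_neg hs]
      ring
  · rw [intervalIntegral.integral_of_ge h.le, integral_Ioc_eq_integral_Ioo, neg_neg,
      ← integral_indicator measurableSet_Ioo]
    congr 1 with s
    by_cases hs : b 0 < s ∧ s < a 0
    · rw [Set.indicator_of_mem (Set.mem_Ioo.mpr hs)]
      simp only [σ]
      rw [if_pos hs, one_mul]
    · rw [Set.indicator_of_notMem (by simpa using hs)]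
      simp only [σ]
      rw [if_neg hs, if_neg (fun h1 => by linarith [h1.1, h1.2])]
      ring

/-- The vertical unit vector. -/
def vert : Plane := EuclideanSpace.single 1 1

lemma integral_Iio_eq_intervalIntegral {f : Plane → ℝ} {p : Plane} {R : ℝ}
    (hR0 : 0 ≤ R) (hR : ∀ s, R ≤ s → f (p - s • vert) = 0) :
    ∫ t in Set.Iio (p 1), f !₂[p 0, t] = ∫ s in (0 : ℝ)..R, f (p - s • vert) := by
  have h1 : ∀ s, f (p - s • vert) = f !₂[p 0, p 1 - s] := by
    intro s
    congr 1
    ext i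
    fin_cases i <;> simp [vert]
  simp_rw [h1] at hR ⊢
  rw [intervalIntegral.integral_comp_sub_left (fun t => f !₂[p 0, t]), sub_zero,
    intervalIntegral.integral_of_le (by linarith), ← integral_Iic_eq_integral_Iio]
  refine setIntegral_eq_of_subset_of_forall_sdiff_eq_zero measurableSet_Iic
    (fun t ht => ht.2) ?_
  rintro t ⟨ht, ht'⟩
  have h2 : t ≤ p 1 - R := by
    by_contra! h2
    exact ht' ⟨h2, ht⟩
  have h3 := hR (p 1 - t) (by linarith)
  rwa [sub_sub_cancel] at h3

lemma integral_mul_crossing {f : Plane → ℝ} (hf : Continuous f)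
    (hfc : HasCompactSupport f) {a b : Plane} {R : ℝ} (hR0 : 0 ≤ R)
    (hR : ∀ p ∈ segment ℝ a b, ∀ s, R ≤ s → f (p - s • vert) = 0) :
    ∫ y, f y * crossing a b y = -((b 0 - a 0) * ∫ t in (0 : ℝ)..1, ∫ s in (0 : ℝ)..R,
      f (AffineMap.lineMap a b t - s • vert)) := by
  rw [integral_mul_crossing_eq_intervalIntegral hf hfc]
  rcases eq_or_ne (a 0) (b 0) with hab | hab
  · simp [hab]
  have hne : b 0 - a 0 ≠ 0 := sub_ne_zero.mpr hab.symm
  have key := intervalIntegral.integral_comp_mul_add (a := 0) (b := 1) (fun s : ℝ =>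
    ∫ t in Set.Iio (a 1 + (s - a 0) / (b 0 - a 0) * (b 1 - a 1)), f !₂[s, t]) hne (a 0)
  simp only [mul_zero, zero_add, mul_one, sub_add_cancel] at key
  rw [eq_inv_smul_iff₀ hne, smul_eq_mul] at key
  rw [← key]
  congr 2
  refine intervalIntegral.integral_congr fun t ht => ?_
  rw [Set.uIcc_of_le zero_le_one] at ht
  simp only
  rw [← integral_Iio_eq_intervalIntegral hR0 (hR _ (lineMap_mem_segment a b ht))]
  have h0 : (AffineMap.lineMap a b t : Plane) 0 = (b 0 - a 0) * t + a 0 := by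
    simp [AffineMap.lineMap_apply_module']
    ring
  have h1 : (AffineMap.lineMap a b t : Plane) 1 =
      a 1 + ((b 0 - a 0) * t + a 0 - a 0) / (b 0 - a 0) * (b 1 - a 1) := by
    simp [AffineMap.lineMap_apply_module']
    field_simp
    ring
  rw [h0, h1]

lemma continuous_divergence {z : Plane → Plane} (hz : ContDiff ℝ 1 z) :
    Continuous (divergence z) := by
  have h := hz.continuous_fderiv one_ne_zero
  unfold divergence
  fun_prop

lemma divergence_eq_zero {z : Plane → Plane} {p : Plane} (hp : p ∉ tsupport z) :
    divergence z p = 0 := by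
  have h : fderiv ℝ z p = 0 := by
    by_contra h
    exact hp (support_fderiv_subset ℝ h)
  simp [divergence, h]

lemma hasCompactSupport_divergence {z : Plane → Plane} (hzc : HasCompactSupport z) :
    HasCompactSupport (divergence z) :=
  HasCompactSupport.intro hzc fun _ hp => divergence_eq_zero hp

/-- The flux of `z` through a segment, with a potential term that cancels around a closed curve. -/
lemma flux_eq {z : Plane → Plane} (hz : ContDiff ℝ 1 z) {a b : Plane} {R : ℝ}
    (hR : ∀ p ∈ segment ℝ a b, z (p - R • vert) = 0) :
    ∫ t in (0 : ℝ)..1, cross (z (AffineMap.lineMap a b t)) (b - a) =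
      (∫ s in (0 : ℝ)..R, z (b - s • vert) 0) - (∫ s in (0 : ℝ)..R, z (a - s • vert) 0) -
      (b 0 - a 0) * ∫ t in (0 : ℝ)..1, ∫ s in (0 : ℝ)..R,
        divergence z (AffineMap.lineMap a b t - s • vert) := by
  set u := b - a with hu
  have hD : Continuous (fderiv ℝ z) := hz.continuous_fderiv one_ne_zero
  have hdiff : Differentiable ℝ z := hz.differentiable one_ne_zero
  -- Fundamental theorem of calculus down the vertical from the point of the segment to depth `R`,
  -- where `z` vanishes.
  have hstep : ∀ t ∈ Set.Icc (0 : ℝ) 1, cross (z (AffineMap.lineMap a b t)) u =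
      ∫ s in (0 : ℝ)..R, cross (fderiv ℝ z (AffineMap.lineMap a b t - s • vert) vert) u := by
    intro t ht
    set p : Plane := AffineMap.lineMap a b t with hp
    have hderiv : ∀ s ∈ Set.uIcc (0 : ℝ) R, HasDerivAt (fun s : ℝ => -cross (z (p - s • vert)) u)
        (cross (fderiv ℝ z (p - s • vert) vert) u) s := by
      intro s _
      have h1 : HasDerivAt (fun s : ℝ => p - s • vert) (-vert) s := by
        simpa using ((hasDerivAt_id s).smul_const vert).const_sub p
      have h2 := (hdiff (p - s • vert)).hasFDerivAt.comp_hasDerivAt s h1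
      have h3 : ∀ i, HasDerivAt (fun s : ℝ => z (p - s • vert) i)
          (fderiv ℝ z (p - s • vert) (-vert) i) s := fun i =>
        (EuclideanSpace.proj (𝕜 := ℝ) i).hasFDerivAt.comp_hasDerivAt s h2
      convert! (((h3 0).mul_const (u 1)).sub ((h3 1).mul_const (u 0))).neg using 1
      simp [cross]
      ring
    have hcont : Continuous fun s : ℝ => cross (fderiv ℝ z (p - s • vert) vert) u :=
      continuous_cross (by fun_prop) continuous_const
    rw [intervalIntegral.integral_eq_sub_of_hasDerivAt hderiv (hcont.intervalIntegrable _ _),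
      hR p (lineMap_mem_segment a b ht)]
    simp [cross]
  -- This identity splits the integrand into a derivative along the segment, which integrates to the
  -- potential difference, and a divergence term.
  have hpt : ∀ q : Plane, cross (fderiv ℝ z q vert) u =
      (fderiv ℝ z q u) 0 - u 0 * divergence z q := by
    intro q
    have h1 : u = u 0 • EuclideanSpace.single 0 1 + u 1 • vert := by
      ext i
      fin_cases i <;> simp [vert]
    have h2 : fderiv ℝ z q u =
        u 0 • fderiv ℝ z q (EuclideanSpace.single 0 1) + u 1 • fderiv ℝ z q vert := by
      conv_lhs => rw [h1]
      rw [map_add, map_smul, map_smul]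
    rw [h2]
    simp [cross, divergence, vert, Fin.sum_univ_two]
    ring
  have hc1 : Continuous (Function.uncurry fun t s : ℝ =>
      (fderiv ℝ z (AffineMap.lineMap a b t - s • vert) u) 0) := by
    have : Continuous fun q : ℝ × ℝ => (AffineMap.lineMap a b q.1 : Plane) :=
      (continuous_lineMap a b).comp continuous_fst
    simp only [Function.uncurry_def]
    fun_prop
  have hc2 : Continuous (Function.uncurry fun t s : ℝ =>
      divergence z (AffineMap.lineMap a b t - s • vert)) := by
    have h1 : Continuous fun q : ℝ × ℝ => (AffineMap.lineMap a b q.1 : Plane) :=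
      (continuous_lineMap a b).comp continuous_fst
    have h2 := continuous_divergence hz
    simp only [Function.uncurry_def]
    fun_prop
  have hpot : ∀ s : ℝ, ∫ t in (0 : ℝ)..1,
      (fderiv ℝ z (AffineMap.lineMap a b t - s • vert) u) 0 =
        z (b - s • vert) 0 - z (a - s • vert) 0 := by
    intro s
    have hderiv : ∀ t ∈ Set.uIcc (0 : ℝ) 1, HasDerivAt
        (fun t : ℝ => z (AffineMap.lineMap a b t - s • vert) 0)
        ((fderiv ℝ z (AffineMap.lineMap a b t - s • vert) u) 0) t := by
      intro t _
      have h1 : HasDerivAt (fun t : ℝ => (AffineMap.lineMap a b t : Plane)) u t := by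
        simpa using AffineMap.hasDerivAt_lineMap (a := a) (b := b) (x := t)
      have h2 := (hdiff _).hasFDerivAt.comp_hasDerivAt t (h1.sub_const (s • vert))
      exact (EuclideanSpace.proj (𝕜 := ℝ) 0).hasFDerivAt.comp_hasDerivAt t h2
    have hcont : Continuous fun t : ℝ =>
        (fderiv ℝ z (AffineMap.lineMap a b t - s • vert) u) 0 :=
      hc1.comp (f := fun t : ℝ => (t, s)) (by fun_prop)
    rw [intervalIntegral.integral_eq_sub_of_hasDerivAt hderiv (hcont.intervalIntegrable _ _)]
    simp
  have hzc := hz.continuous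
  have hcz : ∀ c : Plane, IntervalIntegrable (fun s : ℝ => z (c - s • vert) 0) volume 0 R :=
    fun c => (by fun_prop : Continuous fun s : ℝ => z (c - s • vert) 0).intervalIntegrable _ _
  calc ∫ t in (0 : ℝ)..1, cross (z (AffineMap.lineMap a b t)) u
      = ∫ t in (0 : ℝ)..1, ((∫ s in (0 : ℝ)..R,
          (fderiv ℝ z (AffineMap.lineMap a b t - s • vert) u) 0) -
            u 0 * ∫ s in (0 : ℝ)..R, divergence z (AffineMap.lineMap a b t - s • vert)) := by
        refine intervalIntegral.integral_congr fun t ht => ?_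
        rw [Set.uIcc_of_le zero_le_one] at ht
        simp only
        rw [hstep t ht]
        simp_rw [hpt]
        have i1 : Continuous fun s : ℝ =>
            (fderiv ℝ z (AffineMap.lineMap a b t - s • vert) u) 0 :=
          hc1.comp (f := fun s : ℝ => (t, s)) (by fun_prop)
        have i2 : Continuous fun s : ℝ => divergence z (AffineMap.lineMap a b t - s • vert) :=
          hc2.comp (f := fun s : ℝ => (t, s)) (by fun_prop)
        rw [intervalIntegral.integral_sub (i1.intervalIntegrable _ _)
          ((i2.intervalIntegrable _ _).const_mul _), intervalIntegral.integral_const_mul]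
    _ = (∫ t in (0 : ℝ)..1, ∫ s in (0 : ℝ)..R,
          (fderiv ℝ z (AffineMap.lineMap a b t - s • vert) u) 0) -
          u 0 * ∫ t in (0 : ℝ)..1, ∫ s in (0 : ℝ)..R,
            divergence z (AffineMap.lineMap a b t - s • vert) := by
        have i1 := intervalIntegral.continuous_parametric_intervalIntegral_of_continuous' hc1 0 R
          (μ := volume)
        have i2 := intervalIntegral.continuous_parametric_intervalIntegral_of_continuous' hc2 0 R
          (μ := volume)
        rw [intervalIntegral.integral_sub (i1.intervalIntegrable _ _)
          ((i2.intervalIntegrable _ _).const_mul _), intervalIntegral.integral_const_mul]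
    _ = _ := by
        rw [intervalIntegral_intervalIntegral_swap]
        · simp_rw [hpot]
          rw [intervalIntegral.integral_sub (hcz b) (hcz a)]
          simp [hu]
        · refine (hc1.continuousOn.integrableOn_compact
            ((isCompact_uIcc (a := 0) (b := 1)).prod (isCompact_uIcc (a := 0) (b := R)))).mono_set ?_
          exact Set.prod_mono Set.uIoc_subset_uIcc Set.uIoc_subset_uIcc

/-- The Gauss-Green formula for closed polygonal curves. -/
theorem integral_wind_mul_divergence {z : Plane → Plane} (hz : ContDiff ℝ 1 z)
    (hzc : HasCompactSupport z) {m : ℕ} (x : Polygon Plane m) :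
    ∫ y, divergence z y * wind x y =
      edgeSum (fun a b => ∫ t in (0 : ℝ)..1, cross (z (AffineMap.lineMap a b t)) (b - a)) x := by
  obtain ⟨ρ, hρ⟩ := hzc.isCompact.isBounded.subset_closedBall 0
  obtain ⟨B, hB⟩ := (isCompact_boundary x).isBounded.subset_closedBall 0
  -- Lowering any point of the curve by at least this amount takes it out of the support of `z`.
  set R : ℝ := |ρ| + |B| + 1
  have hR : ∀ i, ∀ p ∈ segment ℝ (x i) (x (finRotate m i)), ∀ s, R ≤ s →
      p - s • vert ∉ tsupport z := by
    intro i p hp s hs hmem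
    have h1 := hρ hmem
    have h2 := hB (mem_boundary_iff.mpr ⟨i, hp⟩)
    rw [mem_closedBall_zero_iff] at h1 h2
    have h3 : ‖s • vert‖ = |s| := by
      rw [norm_smul]
      simp [vert]
    have h4 := norm_sub_norm_le (s • vert) p
    rw [h3, norm_sub_rev] at h4
    linarith [le_abs_self s, le_abs_self ρ, le_abs_self B, hs]
  have hf := continuous_divergence hz
  have hfc := hasCompactSupport_divergence hzc
  have hR0 : 0 ≤ R := by positivity
  calc ∫ y, divergence z y * wind x y
      = ∫ y, ∑ i, divergence z y * crossing (x i) (x (finRotate m i)) y := by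
        apply integral_congr_ae
        filter_upwards [ae_wind_eq x] with y hy
        rw [hy, edgeSum, Finset.mul_sum]
    _ = ∑ i, ∫ y, divergence z y * crossing (x i) (x (finRotate m i)) y :=
        integral_finsetSum _ fun i _ => integrable_mul_crossing hf hfc _ _
    _ = ∑ i, ((∫ t in (0 : ℝ)..1, cross (z (AffineMap.lineMap (x i) (x (finRotate m i)) t))
          (x (finRotate m i) - x i)) - ((∫ s in (0 : ℝ)..R, z (x (finRotate m i) - s • vert) 0) -
            ∫ s in (0 : ℝ)..R, z (x i - s • vert) 0)) := by
        refine Finset.sum_congr rfl fun i _ => ?_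
        rw [integral_mul_crossing hf hfc hR0 fun p hp s hs => divergence_eq_zero (hR i p hp s hs),
          flux_eq hz fun p hp => image_eq_zero_of_notMem_tsupport (hR i p hp R le_rfl)]
        ring
    _ = _ := by
        -- The potentials at the vertices cancel around the closed curve.
        rw [Finset.sum_sub_distrib, Finset.sum_sub_distrib,
          Equiv.sum_comp (finRotate m) fun i => ∫ s in (0 : ℝ)..R, z (x i - s • vert) 0,
          sub_self, sub_zero]
        rfl

/-! ### The perimeter of a simple polygon -/

lemma norm_rotate (u : Plane) : ‖rotate u‖ = ‖u‖ := by
  rw [← sq_eq_sq₀ (norm_nonneg _) (norm_nonneg _), norm_sq_eq, norm_sq_eq]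
  simp [rotate]
  ring

lemma integral_indicator_region_mul {m : ℕ} {x : Polygon Plane m} {s : ℝ} (hs : |s| = 1)
    (h : ∀ y ∉ x.boundary ℝ, wind x y = (region x).indicator (fun _ => s) y)
    {z : Plane → Plane} (hz : ContDiff ℝ 1 z) (hzc : HasCompactSupport z) :
    -∫ p, (region x).indicator (fun _ => 1) p * divergence z p =
      edgeSum (fun a b => ∫ t in (0 : ℝ)..1, -s * cross (z (AffineMap.lineMap a b t)) (b - a))
        x := by
  have hss : s * s = 1 := by rw [← abs_mul_abs_self, hs, one_mul]
  have h1 : ∫ p, (region x).indicator (fun _ => 1) p * divergence z p =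
      s * ∫ y, divergence z y * wind x y := by
    rw [← integral_const_mul]
    apply integral_congr_ae
    filter_upwards [ae_notMem_boundary x] with y hy
    rw [h y hy]
    by_cases hyr : y ∈ region x
    · simp only [Set.indicator_of_mem hyr]
      linear_combination -divergence z y * hss
    · simp [hyr]
  rw [h1, integral_wind_mul_divergence hz hzc]
  unfold edgeSum
  simp_rw [intervalIntegral.integral_const_mul]
  rw [← Finset.mul_sum]
  ring

/-- By Gauss-Green the integral is a flux through the sides, and a field of norm at most one has
flux at most the length of each side. -/
lemma perimeter_region_le {m : ℕ} {x : Polygon Plane m} {s : ℝ} (hs : |s| = 1)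
    (h : ∀ y ∉ x.boundary ℝ, wind x y = (region x).indicator (fun _ => s) y) :
    perimeter (region x) ≤ ENNReal.ofReal (length x) := by
  refine iSup_le fun z => iSup_le fun hz => iSup_le fun hzc => iSup_le fun hz1 => ?_
  apply ENNReal.ofReal_le_ofReal
  rw [integral_indicator_region_mul hs h (hz.of_le (by norm_cast)) hzc]
  refine Finset.sum_le_sum fun i _ => ?_
  refine (le_abs_self _).trans ?_
  have hle := intervalIntegral.norm_integral_le_of_norm_le_const (a := 0) (b := 1)
    (f := fun t : ℝ => -s * cross (z (AffineMap.lineMap (x i) (x (finRotate m i)) t))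
      (x (finRotate m i) - x i)) (C := ‖x (finRotate m i) - x i‖) fun t _ => ?_
  · rwa [sub_zero, abs_one, mul_one] at hle
  rw [Real.norm_eq_abs, abs_mul, abs_neg, hs, one_mul]
  refine (abs_cross_le _ _).trans ?_
  exact mul_le_of_le_one_left (norm_nonneg _) (hz1 _)

/-- The middle interval contributes at least `(1 - 2δ) M`, and the two end intervals cost at most
`2δ M`. -/
lemma le_intervalIntegral_of_le {g : ℝ → ℝ} (hg : Continuous g) {M δ : ℝ} (hδ : 0 < δ)
    (hδ' : δ < 1 / 2) (h : ∀ t, -M ≤ g t) (h' : ∀ t ∈ Set.Icc δ (1 - δ), M ≤ g t) :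
    (1 - 4 * δ) * M ≤ ∫ t in (0 : ℝ)..1, g t := by
  have hI : ∀ a b : ℝ, IntervalIntegrable g volume a b := fun a b => hg.intervalIntegrable a b
  have hconst : ∀ {a b c : ℝ}, a ≤ b → (∀ t ∈ Set.Icc a b, c ≤ g t) →
      (b - a) * c ≤ ∫ t in a..b, g t := by
    intro a b c hab hc
    have := intervalIntegral.integral_mono_on hab intervalIntegrable_const (hI a b) hc
    simpa using this
  have h1 := hconst hδ.le fun t _ => h t
  have h2 := hconst (by linarith : δ ≤ 1 - δ) h'
  have h3 := hconst (by linarith : 1 - δ ≤ 1) fun t _ => h t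
  rw [← intervalIntegral.integral_add_adjacent_intervals (hI 0 δ) (hI δ 1),
    ← intervalIntegral.integral_add_adjacent_intervals (hI δ (1 - δ)) (hI (1 - δ) 1)]
  linarith

/-- Finitely many disjoint compact sets can be separated by smooth cut-off functions. -/
lemma exists_cutoff {ι : Type*} [Finite ι] {K : ι → Set Plane} (hK : ∀ i, IsCompact (K i))
    (hdisj : ∀ i j, i ≠ j → Disjoint (K i) (K j)) :
    ∃ φ : ι → Plane → ℝ, (∀ i, ContDiff ℝ ∞ (φ i)) ∧ (∀ i, HasCompactSupport (φ i)) ∧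
      (∀ i p, φ i p ∈ Set.Icc (0 : ℝ) 1) ∧ (∀ i, ∀ p ∈ K i, φ i p = 1) ∧
      ∀ i j, i ≠ j → ∀ p, φ i p ≠ 0 → φ j p = 0 := by
  have hev : ∀ᶠ r : ℝ in nhdsWithin 0 (Set.Ioi 0), ∀ i j, i ≠ j →
      Disjoint (Metric.thickening r (K i)) (Metric.thickening r (K j)) := by
    simp only [Filter.eventually_all]
    intro i j hij
    obtain ⟨ρ, hρ, hd⟩ := (hdisj i j hij).exists_thickenings (hK i) (hK j).isClosed
    filter_upwards [Ioo_mem_nhdsGT hρ] with r hr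
    exact hd.mono (Metric.thickening_mono hr.2.le _) (Metric.thickening_mono hr.2.le _)
  obtain ⟨r, hr, hr0⟩ := (hev.and self_mem_nhdsWithin).exists
  have hex : ∀ i, ∃ f : Plane → ℝ, ContDiff ℝ ∞ f ∧ Set.range f ⊆ Set.Icc 0 1 ∧
      Function.support f = Metric.thickening r (K i) ∧ ∀ p, p ∈ K i ↔ f p = 1 := by
    intro i
    obtain ⟨f, hf, h⟩ := exists_contMDiff_support_eq_eq_one_iff (modelWithCornersSelf ℝ Plane)
      (n := ⊤) (Metric.isOpen_thickening (δ := r) (E := K i)) (hK i).isClosed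
      (Metric.self_subset_thickening hr0 _)
    exact ⟨f, hf.contDiff, h⟩
  choose φ hφ hrange hsupp hone using hex
  refine ⟨φ, hφ, fun i => ?_, fun i p => hrange i ⟨p, rfl⟩, fun i p hp => (hone i p).mp hp,
    fun i j hij p hp => ?_⟩
  · have hb : Bornology.IsBounded (tsupport (φ i)) := by
      rw [tsupport, hsupp]
      exact (hK i).isBounded.thickening.closure
    exact Metric.isCompact_of_isClosed_isBounded (isClosed_tsupport _) hb
  · by_contra hj
    rw [← Function.mem_support, hsupp] at hp
    rw [← Ne, ← Function.mem_support, hsupp] at hj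
    exact Set.disjoint_left.mp (hr i j hij) hp hj

/-- The sides with their ends cut off are disjoint compact sets, so cut-off functions glue the unit
normals into one admissible field. Near the vertices nothing is known but the norm bound, which
costs the factor `1 - 4δ`. -/
lemma le_perimeter_region {m : ℕ} (hm : 2 ≤ m) {x : Polygon Plane (m + 1)} (hx : IsSimple x)
    {s : ℝ} (hs : |s| = 1)
    (h : ∀ y ∉ x.boundary ℝ, wind x y = (region x).indicator (fun _ => s) y) {δ : ℝ} (hδ : 0 < δ)
    (hδ' : δ < 1 / 2) : ENNReal.ofReal ((1 - 4 * δ) * length x) ≤ perimeter (region x) := by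
  have hss : s * s = 1 := by rw [← abs_mul_abs_self, hs, one_mul]
  have hne : ∀ i, x i ≠ x (i + 1) := fun i => by simpa using hx.nondegenerate i
  let u : Fin (m + 1) → Plane := fun i => x (i + 1) - x i
  have hu : ∀ i, 0 < ‖u i‖ := fun i => norm_pos_iff.mpr (sub_ne_zero.mpr (hne i).symm)
  let K : Fin (m + 1) → Set Plane := fun i =>
    (fun t : ℝ => (AffineMap.lineMap (x i) (x (i + 1)) t : Plane)) '' Set.Icc δ (1 - δ)
  have hK : ∀ i, IsCompact (K i) := fun i => isCompact_Icc.image (continuous_lineMap _ _)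
  have hdisj : ∀ i j, i ≠ j → Disjoint (K i) (K j) := by
    intro i j hij
    rw [Set.disjoint_left]
    rintro _ ⟨t, ht, rfl⟩ ⟨t', ht', h'⟩
    refine hij (eq_of_mem_segment_of_interior hm hx (i := i) (j := j) (t := t)
      ⟨by linarith [ht.1], by linarith [ht.2]⟩ ?_).symm
    have hmem := lineMap_mem_segment (x j) (x (j + 1))
      (⟨by linarith [ht'.1], by linarith [ht'.2]⟩ : t' ∈ Set.Icc (0 : ℝ) 1)
    exact (congrArg (· ∈ segment ℝ (x j) (x (j + 1))) h').mp hmem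
  obtain ⟨φ, hφ, hφc, hφ01, hφ1, hφd⟩ := exists_cutoff hK hdisj
  -- The sign `s` is the orientation of the curve; it makes every side contribute with the same
  -- sign.
  let n : Fin (m + 1) → Plane := fun i => (s / ‖u i‖) • rotate (u i)
  have hn : ∀ i, ‖n i‖ = 1 := by
    intro i
    simp only [n]
    rw [norm_smul, norm_rotate, norm_div, Real.norm_eq_abs, hs, norm_norm,
      one_div_mul_cancel (hu i).ne']
  have hcross : ∀ i, -s * cross (n i) (u i) = ‖u i‖ := by
    intro i
    simp only [n]
    rw [cross_smul_left, cross_swap, cross_rotate]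
    have := (hu i).ne'
    field_simp
    linear_combination hss
  let z : Plane → Plane := fun p => ∑ i, φ i p • n i
  have hz : ContDiff ℝ ∞ z := ContDiff.sum fun i _ => (hφ i).smul contDiff_const
  have hzval : ∀ i p, φ i p ≠ 0 → z p = φ i p • n i := by
    intro i p hp
    refine Finset.sum_eq_single i (fun j _ hj => ?_) (by simp)
    rw [hφd i j hj.symm p hp, zero_smul]
  have hzc : HasCompactSupport z := by
    refine HasCompactSupport.intro (isCompact_iUnion fun i => (hφc i).isCompact) fun p hp => ?_
    refine Finset.sum_eq_zero fun i _ => ?_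
    rw [image_eq_zero_of_notMem_tsupport fun h' => hp (Set.mem_iUnion.mpr ⟨i, h'⟩), zero_smul]
  have hz1 : ∀ p, ‖z p‖ ≤ 1 := by
    intro p
    by_cases hp : ∃ i, φ i p ≠ 0
    · obtain ⟨i, hi⟩ := hp
      rw [hzval i p hi, norm_smul, hn, mul_one, Real.norm_eq_abs, abs_of_nonneg (hφ01 i p).1]
      exact (hφ01 i p).2
    · push Not at hp
      simp [z, hp]
  refine le_trans ?_ (le_iSup_of_le z (le_iSup_of_le hz (le_iSup_of_le hzc
    (le_iSup_of_le hz1 le_rfl))))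
  apply ENNReal.ofReal_le_ofReal
  rw [integral_indicator_region_mul hs h (hz.of_le (by norm_cast)) hzc,
    length, Finset.mul_sum]
  refine Finset.sum_le_sum fun i _ => ?_
  rw [finRotate_apply]
  refine le_intervalIntegral_of_le ?_ hδ hδ' (fun t => ?_) fun t ht => ?_
  · exact continuous_const.mul (continuous_cross
      (hz.continuous.comp (continuous_lineMap _ _)) continuous_const)
  · refine (abs_le.mp ?_).1
    rw [abs_mul, abs_neg, hs, one_mul]
    exact (abs_cross_le _ _).trans (mul_le_of_le_one_left (norm_nonneg _) (hz1 _))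
  · have h1 := hφ1 i _ (Set.mem_image_of_mem _ ht)
    rw [hzval i _ (by rw [h1]; exact one_ne_zero), h1, one_smul]
    exact (hcross i).ge

/-- The perimeter of a simple polygon is the length of its boundary curve. -/
theorem perimeter_region {m : ℕ} (hm : 3 ≤ m) {x : Polygon Plane m} (hx : IsSimple x) :
    perimeter (region x) = ENNReal.ofReal (length x) := by
  obtain ⟨s, hs, h⟩ := exists_wind_eq_indicator hm hx
  refine le_antisymm (perimeter_region_le hs h) ?_
  obtain ⟨m, rfl⟩ : ∃ k, m = k + 1 := ⟨m - 1, by omega⟩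
  have hlim : Filter.Tendsto (fun δ : ℝ => ENNReal.ofReal ((1 - 4 * δ) * length x))
      (nhdsWithin 0 (Set.Ioi 0)) (nhds (ENNReal.ofReal (length x))) := by
    have hc : Continuous fun δ : ℝ => ENNReal.ofReal ((1 - 4 * δ) * length x) :=
      ENNReal.continuous_ofReal.comp (by fun_prop)
    simpa using (hc.tendsto 0).mono_left nhdsWithin_le_nhds
  refine le_of_tendsto hlim ?_
  filter_upwards [Ioo_mem_nhdsGT (show (0 : ℝ) < 1 / 2 by norm_num)] with δ hδ
  exact le_perimeter_region (by omega) hx hs h hδ.1 hδ.2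

theorem cheegerRatio_region (η : Plane → ℝ) {m : ℕ} (hm : 3 ≤ m) {x : Polygon Plane m}
    (hx : IsSimple x) : cheegerRatio η (region x) = relaxedEnergy η x := by
  rw [cheegerRatio, relaxedEnergy, perimeter_region hm hx, abs_relaxedArea_eq η hm hx,
    ENNReal.toReal_ofReal (length_nonneg x)]

lemma length_pos_of_isSimple {m : ℕ} (hm : 3 ≤ m) {x : Polygon Plane m} (hx : IsSimple x) :
    0 < length x :=
  Finset.sum_pos (fun i _ => norm_pos_iff.mpr (sub_ne_zero.mpr (hx.nondegenerate i).symm))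
    ⟨⟨0, by omega⟩, Finset.mem_univ _⟩

end CheegerPolygon

end

theorem mainTheorem10 (η : CheegerPolygon.Plane → ℝ) (hη : MemLp η 2 volume)
    (hc : Continuous η) (n : ℕ) (hn : 3 ≤ n) :
    -- on simple polygons, the relaxed quantities coincide with the original ones
    (∀ m : ℕ, 3 ≤ m → ∀ x : Polygon CheegerPolygon.Plane m, CheegerPolygon.IsSimple x →
      CheegerPolygon.perimeter (CheegerPolygon.region x)
          = ENNReal.ofReal (CheegerPolygon.length x) ∧
        |CheegerPolygon.relaxedArea η x| = |∫ p in CheegerPolygon.region x, η p| ∧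
        CheegerPolygon.cheegerRatio η (CheegerPolygon.region x)
          = CheegerPolygon.relaxedEnergy η x) ∧
    -- the relaxed energy has a maximizer that is a simple polygon, and this polygon maximizes
    -- the Cheeger ratio among simple polygons with at most `n` sides
    ∃ x : Polygon CheegerPolygon.Plane n, CheegerPolygon.IsSimple x ∧
      x ∈ CheegerPolygon.polygonalCurves n ∧
      IsMaxOn (CheegerPolygon.relaxedEnergy η) (CheegerPolygon.polygonalCurves n) x ∧
      CheegerPolygon.region x ∈ CheegerPolygon.simplePolygons n ∧
      IsMaxOn (CheegerPolygon.cheegerRatio η) (CheegerPolygon.simplePolygons n)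
        (CheegerPolygon.region x) := by
  refine ⟨fun m hm x hx => ⟨CheegerPolygon.perimeter_region hm hx,
    CheegerPolygon.abs_relaxedArea_eq η hm hx, CheegerPolygon.cheegerRatio_region η hm hx⟩, ?_⟩
  obtain ⟨x, hx, hmax⟩ := CheegerPolygon.exists_isSimple_forall_relaxedEnergy_le hη hc hn
  refine ⟨x, hx, CheegerPolygon.length_pos_of_isSimple hn hx, fun z _ => hmax z,
    ⟨n, hn, le_rfl, x, hx, rfl⟩, ?_⟩
  rintro E ⟨m, hm, hmn, y, hy, rfl⟩
  -- A polygon with fewer sides is padded to `n` vertices, where the maximality of the relaxed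
  -- energy applies.
  obtain ⟨y', -, hl, hA⟩ := CheegerPolygon.exists_isSimple_of_le hm hmn hy
  have h : CheegerPolygon.relaxedEnergy η y = CheegerPolygon.relaxedEnergy η y' := by
    rw [CheegerPolygon.relaxedEnergy, CheegerPolygon.relaxedEnergy, hl, hA]
  change CheegerPolygon.cheegerRatio η _ ≤ CheegerPolygon.cheegerRatio η _
  rw [CheegerPolygon.cheegerRatio_region η hm hy, CheegerPolygon.cheegerRatio_region η hn hx, h]
  exact hmax y'
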